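/- All graphs are finite, simple and undirected. A threshold function for a graph $G$ is a function $\tau:V(G)\to\mathbb{Z}$. For $D\subseteq V(G)$, the hull $H_{(G,\tau)}(D)$ is the smallest set $H\subseteq V(G)$ with $D\subseteq H$ such that $u\in H$ for every vertex $u$ with $|H\cap N_G(u)|\ge\tau(u)$. A function $\sigma:V(G)\to\mathbb{N}_0$ is a partial incentive of $(G,\tau)$ if $H_{(G,\tau-\sigma)}(\emptyset)=V(G)$, and it is optimal if its weight $\sum_{u\in V(G)}\sigma(u)$ is minimum among all partial incentives of $(G,\tau)$. A graph is an interval graph if its vertices can be represented by closed real intervals such that two distinct vertices are adjacent if and only if their intervals intersect. Theorem. Let $t$ be a non-negative integer. For a given pair $(G,\tau)$, where $G$ is an interval graph of order $n$ and $\tau$ is a threshold function for $G$ with $\tau(u)\le t$ for every vertex $u$ of $G$, an optimal partial incentive of $(G,\tau)$ can be determined in time $n^{O(t^2)}$. More precisely, there are an absolute constant $c$ and a single algorithm (a program of a unit-cost random access machine with integer registers and the operations addition, subtraction, comparison and indirect addressing; the input consists of $n$, the adjacency matrix of $G$ and the values of $\tau$) such that, for all $t$, $n$ and $(G,\tau)$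 as above, the algorithm halts after at most $\max\{n,2\}^{c(t^2+1)}$ steps and outputs an optimal partial incentive of $(G,\tau)$. -/

import Mathlib

/-! ## Interval graphs, hulls and partial incentives -/

namespace PartialIncentives

/-- `G` is an interval graph: its vertices can be represented by nonempty closed real intervals such
that two distinct vertices are adjacent exactly when their intervals intersect. -/
def IsIntervalGraph {V : Type*} (G : SimpleGraph V) : Prop :=
  ∃ l r : V → ℝ, (∀ u, l u ≤ r u) ∧
    ∀ u v, u ≠ v → (G.Adj u v ↔ (Set.Icc (l u) (r u) ∩ Set.Icc (l v) (r v)).Nonempty)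

/-- `H` contains every vertex `u` that has at least `τ u` neighbors in `H`. -/
def IsHullClosed {V : Type*} (G : SimpleGraph V) (τ : V → ℤ) (H : Set V) : Prop :=
  ∀ u, τ u ≤ ((H ∩ G.neighborSet u).ncard : ℤ) → u ∈ H

/-- The hull of `D` in `(G, τ)`: the smallest set of vertices that contains `D` and contains
every vertex `u` with at least `τ u` neighbors in the set. -/
def hull {V : Type*} (G : SimpleGraph V) (τ : V → ℤ) (D : Set V) : Set V :=
  ⋂₀ {H | D ⊆ H ∧ IsHullClosed G τ H}

/-- The intersection defining the hull is indeed the smallest such set. -/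
theorem isLeast_hull {V : Type*} [Finite V] (G : SimpleGraph V) (τ : V → ℤ) (D : Set V) :
    IsLeast {H | D ⊆ H ∧ IsHullClosed G τ H} (hull G τ D) := by
  refine ⟨⟨Set.subset_sInter fun H hH => hH.1, fun u hu => ?_⟩, fun H hH => Set.sInter_subset_of_mem hH⟩
  refine Set.mem_sInter.2 fun H hH => hH.2 u (hu.trans ?_)
  exact_mod_cast Set.ncard_le_ncard
    (Set.inter_subset_inter_left _ (Set.sInter_subset_of_mem hH)) (Set.toFinite _)

/-- `σ` is a partial incentive of `(G, τ)`: the hull of the empty set in `(G, τ - σ)` is `V(G)`. -/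
def IsPartialIncentive {V : Type*} (G : SimpleGraph V) (τ : V → ℤ) (σ : V → ℕ) : Prop :=
  hull G (fun u => τ u - (σ u : ℤ)) ∅ = Set.univ

/-- `σ` is a partial incentive of `(G, τ)` of minimum weight. -/
def IsOptimalPartialIncentive {V : Type*} [Fintype V] (G : SimpleGraph V) (τ : V → ℤ)
    (σ : V → ℕ) : Prop :=
  IsPartialIncentive G τ σ ∧
    ∀ σ' : V → ℕ, IsPartialIncentive G τ σ' → ∑ u, σ u ≤ ∑ u, σ' u

/-! ## Random access machine programs with unit-cost steps

A program works on integer registers and on integer arrays with computed indices. The arithmetic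
operations are addition and subtraction only, so that the model is polynomially equivalent to
Turing machines. -/

/-- A memory state: registers `reg i`, and arrays `arr a` with entries `arr a i`. -/
structure State where
  reg : ℕ → ℤ
  arr : ℕ → ℤ → ℤ

/-- Integer expressions. -/
inductive Expr : Type
  | lit (z : ℤ)
  | reg (i : ℕ)
  | get (a : ℕ) (e : Expr)
  | add (e f : Expr)
  | sub (e f : Expr)

/-- The value of an expression in a memory state. -/
def Expr.eval (s : State) : Expr → ℤ
  | .lit z => z
  | .reg i => s.reg i
  | .get a e => s.arr a (e.eval s)
  | .add e f => e.eval s + f.eval s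
  | .sub e f => e.eval s - f.eval s

/-- The number of steps for evaluating an expression: one for each constant, register access,
array access, addition and subtraction. -/
def Expr.cost : Expr → ℕ
  | .lit _ => 1
  | .reg _ => 1
  | .get _ e => e.cost + 1
  | .add e f => e.cost + f.cost + 1
  | .sub e f => e.cost + f.cost + 1

/-- Programs. The tests of `ite` and `while` are whether the expression has a positive value. -/
inductive Prog : Type
  | skip
  | assign (i : ℕ) (e : Expr)
  | put (a : ℕ) (e f : Expr)
  | seq (p q : Prog)
  | ite (e : Expr) (p q : Prog)
  | while (e : Expr) (p : Prog)

/-- `Exec p s k s'`: started in the memory state `s`, the program `p` halts after exactly `k` steps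
in the memory state `s'`. -/
inductive Exec : Prog → State → ℕ → State → Prop
  | skip (s : State) : Exec .skip s 1 s
  | assign (i : ℕ) (e : Expr) (s : State) :
      Exec (.assign i e) s (e.cost + 1) ⟨Function.update s.reg i (e.eval s), s.arr⟩
  | put (a : ℕ) (e f : Expr) (s : State) :
      Exec (.put a e f) s (e.cost + f.cost + 1)
        ⟨s.reg, Function.update s.arr a (Function.update (s.arr a) (e.eval s) (f.eval s))⟩
  | seq {p q : Prog} {s s' s'' : State} {k l : ℕ} :
      Exec p s k s' → Exec q s' l s'' → Exec (.seq p q) s (k + l) s''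
  | iteTrue {e : Expr} {p q : Prog} {s s' : State} {k : ℕ} :
      0 < e.eval s → Exec p s k s' → Exec (.ite e p q) s (e.cost + 1 + k) s'
  | iteFalse {e : Expr} {p q : Prog} {s s' : State} {k : ℕ} :
      ¬ 0 < e.eval s → Exec q s k s' → Exec (.ite e p q) s (e.cost + 1 + k) s'
  | whileTrue {e : Expr} {p : Prog} {s s' s'' : State} {k l : ℕ} :
      0 < e.eval s → Exec p s k s' → Exec (.while e p) s' l s'' →
        Exec (.while e p) s (e.cost + 1 + k + l) s''
  | whileFalse {e : Expr} {p : Prog} {s : State} :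
      ¬ 0 < e.eval s → Exec (.while e p) s (e.cost + 1) s

/-- Programs are deterministic: the final state and the number of steps are determined by the
initial state. -/
theorem Exec.deterministic {p : Prog} {s s₁ s₂ : State} {k₁ k₂ : ℕ}
    (h₁ : Exec p s k₁ s₁) (h₂ : Exec p s k₂ s₂) : k₁ = k₂ ∧ s₁ = s₂ := by
  induction h₁ generalizing k₂ s₂ with
  | skip | assign | put => cases h₂; exact ⟨rfl, rfl⟩
  | seq _ _ ih ih' =>
    cases h₂ with
    | seq a b =>
      obtain ⟨rfl, rfl⟩ := ih a
      obtain ⟨rfl, rfl⟩ := ih' b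
      exact ⟨rfl, rfl⟩
  | iteTrue h _ ih | iteFalse h _ ih =>
    cases h₂ <;> first | contradiction | skip
    rename_i a
    obtain ⟨rfl, rfl⟩ := ih a
    exact ⟨rfl, rfl⟩
  | whileTrue h _ _ ih ih' =>
    cases h₂ with
    | whileTrue _ a b =>
      obtain ⟨rfl, rfl⟩ := ih a
      obtain ⟨rfl, rfl⟩ := ih' b
      exact ⟨rfl, rfl⟩
    | whileFalse => contradiction
  | whileFalse h =>
    cases h₂ with
    | whileTrue => contradiction
    | whileFalse => exact ⟨rfl, rfl⟩

open Classical in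
/-- The input `(G, τ)` for a graph on the vertices `0, …, n - 1`: register `0` holds `n`, array `0`
holds the adjacency matrix of `G` row by row, array `1` holds `τ`, and all else is `0`. -/
noncomputable def inputState {n : ℕ} (G : SimpleGraph (Fin n)) (τ : Fin n → ℤ) : State where
  reg i := if i = 0 then (n : ℤ) else 0
  arr a i :=
    if a = 0 then
      if ∃ u v : Fin n, G.Adj u v ∧ i = (u : ℕ) * (n : ℤ) + (v : ℕ) then 1 else 0
    else if a = 1 then
      if h : 0 ≤ i ∧ i < (n : ℤ) then τ ⟨i.toNat, by omega⟩ else 0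
    else 0

/-- The state `s` holds the function `σ` as output, namely in array `2`. -/
def IsOutput {n : ℕ} (s : State) (σ : Fin n → ℕ) : Prop :=
  ∀ u : Fin n, s.arr 2 ((u : ℕ) : ℤ) = (σ u : ℤ)

end PartialIncentives

namespace PartialIncentives

/-! ## Functions computable in polynomial time relative to the loop bounds -/

/-! Of the interval representation only chordality is used: deleting a vertex with smallest right
endpoint again and again gives a perfect elimination ordering. The bag of `i`, namely `i` with its
later neighbors, is a clique, and the bags form a forest in which the parent of `i` is its first
later neighbor.

A partial incentive reaches the vertices in some order. Once `t` vertices of a clique are reached,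
every other vertex of it has `t` reached neighbors and follows for free. Hence for each bag it
suffices to record the first `t` vertices reached, each with at most `t` neighbors that support it.
Such a local schedule has `t * (t + 1)` entries with `n + 1` possible values each, which is the
source of the exponent `O(t^2)`.

Schedules read off one global order are locally valid and agree between a bag and its parent
(`IsPartialIncentive.exists_schedule`). Conversely, locally valid and compatible schedules suffice,
although they need not come from one global order (`isPartialIncentive_of_valid`). Given a
hull-closed set `H` that is not everything, take the smallest `i` that is the first vertex outside
`H` listed in its own bag. Compatibility along parents makes `i` the first vertex outside `H` in
every bag containing it, so all supporters of `i` lie in `H`, and with its incentive `i` is forced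
into `H`.

The task is therefore to minimize vertex costs plus parent-child costs over labelings of a forest,
where violated constraints cost more than the trivial incentive `max 0 τ`. Dynamic programming does
this (`forest_dp_optimal`, `exists_optimal`).

For the running time, all functions are built from bounded sums whose bounds are stored in array
`9`. Anything so built runs in time polynomial in the largest bound (`PComp`, `PStage`), and that
bound is at most `(n + 2) ^ (t * (t + 1) + t + 1)`. -/

/-- The contents of all arrays. -/
abbrev Arr := ℕ → ℤ → ℤ

/-- All entries of array `9`, which holds the bounds of loops, are at most `B`. -/
def LoopBounded (B : ℕ) (A : Arr) : Prop := ∀ j, A 9 j ≤ B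

/-- `f` is computable from the arrays and from variables held in registers: for every placement `ρ`
of the variables in registers below `r` there is a program that writes the value of `f` to
register `r` and changes neither the arrays nor the registers below `r`. The number of steps is
polynomial in the loop bounds. -/
def PComp (f : Arr → (ℕ → ℤ) → ℤ) : Prop :=
  ∃ c : ℕ, ∀ (ρ : ℕ → ℕ) (r : ℕ), (∀ k, ρ k < r) → ∃ p : Prog,
    ∀ (s : State) (B : ℕ), LoopBounded B s.arr → ∃ (s' : State) (k : ℕ), Exec p s k s' ∧
      s'.arr = s.arr ∧ (∀ i < r, s'.reg i = s.reg i) ∧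
      s'.reg r = f s.arr (fun i => s.reg (ρ i)) ∧ k ≤ (B + 2) ^ c

/-- Since the base is at least 2, constants are absorbed by the exponent. Costs can thus always be
kept in the form of a single power, closed under sums and products. -/
theorem le_add_two_pow (B c : ℕ) : c ≤ (B + 2) ^ c :=
  (Nat.lt_two_pow_self).le.trans (Nat.pow_le_pow_left (by omega) c)

theorem one_le_add_two_pow (B c : ℕ) : 1 ≤ (B + 2) ^ c := Nat.one_le_pow _ _ (by omega)

theorem add_le_add_two_pow {B k l c d : ℕ} (hk : k ≤ (B + 2) ^ c) (hl : l ≤ (B + 2) ^ d) :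
    k + l ≤ (B + 2) ^ (c + d + 1) := by
  have h1 := one_le_add_two_pow B c
  have h2 := one_le_add_two_pow B d
  have : (B + 2) ^ (c + d + 1) = (B + 2) ^ c * (B + 2) ^ d * (B + 2) := by ring
  rw [this]
  nlinarith [Nat.mul_le_mul h1 h2, mul_le_mul' (le_refl ((B + 2) ^ c)) h2,
    mul_le_mul' h1 (le_refl ((B + 2) ^ d))]

theorem mul_le_add_two_pow {B k l c d : ℕ} (hk : k ≤ (B + 2) ^ c) (hl : l ≤ (B + 2) ^ d) :
    k * l ≤ (B + 2) ^ (c + d) := by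
  rw [pow_add]; exact Nat.mul_le_mul hk hl

/-- Put a new variable in front. -/
def push (z : ℤ) (v : ℕ → ℤ) : ℕ → ℤ
  | 0 => z
  | k + 1 => v k

theorem PComp.ofExpr (e : (ℕ → ℕ) → Expr) {f : Arr → (ℕ → ℤ) → ℤ} (c : ℕ)
    (hc : ∀ ρ, (e ρ).cost ≤ c)
    (he : ∀ ρ s, (e ρ).eval s = f s.arr (fun i => s.reg (ρ i))) : PComp f := by
  refine ⟨c + 1, fun ρ r _ => ⟨.assign r (e ρ), fun s B _ =>
    ⟨_, _, Exec.assign r (e ρ) s, rfl, ?_, ?_, ?_⟩⟩⟩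
  · intro i hi
    simp [Function.update_of_ne hi.ne]
  · simp [he]
  · exact (Nat.succ_le_succ (hc ρ)).trans (le_add_two_pow B _)

theorem PComp.const (z : ℤ) : PComp (fun _ _ => z) :=
  .ofExpr (fun _ => .lit z) 1 (fun _ => le_rfl) (fun _ _ => rfl)

theorem PComp.var (k : ℕ) : PComp (fun _ v => v k) :=
  .ofExpr (fun ρ => .reg (ρ k)) 1 (fun _ => le_rfl) (fun _ _ => rfl)

theorem PComp.rename {f : Arr → (ℕ → ℤ) → ℤ} (h : PComp f) (ξ : ℕ → ℕ) :
    PComp (fun A v => f A (fun k => v (ξ k))) := by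
  obtain ⟨c, h⟩ := h
  exact ⟨c, fun ρ r hρ => h (fun k => ρ (ξ k)) r (fun k => hρ _)⟩

/-- The value of `g` stays in register `r` and serves as variable `0` of `f`, whose workspace starts
at `r + 1`. This is why `PComp` quantifies over all placements of the variables. -/
theorem PComp.letIn {f g : Arr → (ℕ → ℤ) → ℤ} (hf : PComp f) (hg : PComp g) :
    PComp (fun A v => f A (push (g A v) v)) := by
  obtain ⟨c, hf⟩ := hf
  obtain ⟨d, hg⟩ := hg
  refine ⟨d + (c + 2 + 1) + 1, fun ρ r hρ => ?_⟩
  obtain ⟨q, hq⟩ := hg ρ r hρ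
  obtain ⟨p, hp⟩ := hf (fun k => Nat.casesOn k r ρ) (r + 1) (by
    rintro (_ | k)
    · exact Nat.lt_succ_self r
    · exact (hρ k).trans (Nat.lt_succ_self r))
  refine ⟨.seq q (.seq p (.assign r (.reg (r + 1)))), fun s B hB => ?_⟩
  obtain ⟨s₁, k, e₁, a₁, r₁, v₁, c₁⟩ := hq s B hB
  obtain ⟨s₂, l, e₂, a₂, r₂, v₂, c₂⟩ := hp s₁ B (by rwa [a₁])
  refine ⟨_, _, .seq e₁ (.seq e₂ (.assign _ _ _)), a₂.trans a₁, ?_, ?_, ?_⟩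
  · intro i hi
    simp [Function.update_of_ne hi.ne, r₂ i (by omega), r₁ i hi]
  · simp only [Expr.eval, Function.update_self, v₂, a₁]
    congr 1
    funext k
    cases k with
    | zero => exact v₁
    | succ k => exact r₁ _ (hρ k)
  · exact add_le_add_two_pow c₁ (add_le_add_two_pow c₂ (le_add_two_pow B 2))

theorem PComp.comp₁ {F : Arr → ℤ → ℤ} (hF : PComp fun A v => F A (v 0))
    {f : Arr → (ℕ → ℤ) → ℤ} (hf : PComp f) : PComp (fun A v => F A (f A v)) :=
  hF.letIn hf

/-- The value of `f` is pushed first and that of `g` on top of it. So `g` must skip one variable,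
and `F` finds its arguments in swapped order. -/
theorem PComp.comp₂ {F : Arr → ℤ → ℤ → ℤ} (hF : PComp fun A v => F A (v 0) (v 1))
    {f g : Arr → (ℕ → ℤ) → ℤ} (hf : PComp f) (hg : PComp g) :
    PComp (fun A v => F A (f A v) (g A v)) :=
  ((hF.rename fun k => if k = 0 then 1 else 0).letIn (hg.rename Nat.succ)).letIn hf

theorem PComp.comp₃ {F : Arr → ℤ → ℤ → ℤ → ℤ} (hF : PComp fun A v => F A (v 0) (v 1) (v 2))
    {f g h : Arr → (ℕ → ℤ) → ℤ} (hf : PComp f) (hg : PComp g) (hh : PComp h) :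
    PComp (fun A v => F A (f A v) (g A v) (h A v)) :=
  (((hF.rename fun k => if k = 0 then 2 else if k = 1 then 1 else 0).letIn
    (hh.rename fun k => k + 2)).letIn (hg.rename Nat.succ)).letIn hf

theorem PComp.add {f g : Arr → (ℕ → ℤ) → ℤ} (hf : PComp f) (hg : PComp g) :
    PComp (fun A v => f A v + g A v) :=
  PComp.comp₂ (F := fun _ x y => x + y)
    (.ofExpr (fun ρ => .add (.reg (ρ 0)) (.reg (ρ 1))) 3 (fun _ => le_rfl) (fun _ _ => rfl)) hf hg

theorem PComp.sub {f g : Arr → (ℕ → ℤ) → ℤ} (hf : PComp f) (hg : PComp g) :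
    PComp (fun A v => f A v - g A v) :=
  PComp.comp₂ (F := fun _ x y => x - y)
    (.ofExpr (fun ρ => .sub (.reg (ρ 0)) (.reg (ρ 1))) 3 (fun _ => le_rfl) (fun _ _ => rfl)) hf hg

theorem PComp.get (a : ℕ) {f : Arr → (ℕ → ℤ) → ℤ} (hf : PComp f) :
    PComp (fun A v => A a (f A v)) :=
  PComp.comp₁ (F := fun A x => A a x)
    (.ofExpr (fun ρ => .get a (.reg (ρ 0))) 2 (fun _ => le_rfl) (fun _ _ => rfl)) hf

theorem PComp.itePos {f g h : Arr → (ℕ → ℤ) → ℤ} (hf : PComp f) (hg : PComp g) (hh : PComp h) :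
    PComp (fun A v => if 0 < f A v then g A v else h A v) := by
  obtain ⟨c, hf⟩ := hf
  obtain ⟨d, hg⟩ := hg
  obtain ⟨e, hh⟩ := hh
  refine ⟨c + (2 + (d + e + 1) + 1) + 1, fun ρ r hρ => ?_⟩
  obtain ⟨p, hp⟩ := hf ρ r hρ
  obtain ⟨q, hq⟩ := hg ρ r hρ
  obtain ⟨q', hq'⟩ := hh ρ r hρ
  refine ⟨.seq p (.ite (.reg r) q q'), fun s B hB => ?_⟩
  obtain ⟨s₁, k, e₁, a₁, r₁, v₁, c₁⟩ := hp s B hB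
  have hv : (fun i => s₁.reg (ρ i)) = fun i => s.reg (ρ i) := funext fun i => r₁ _ (hρ i)
  by_cases hpos : 0 < f s.arr fun i => s.reg (ρ i)
  · obtain ⟨s₂, l, e₂, a₂, r₂, v₂, c₂⟩ := hq s₁ B (by rwa [a₁])
    refine ⟨_, _, .seq e₁ (.iteTrue (by simpa [Expr.eval, v₁] using hpos) e₂), a₂.trans a₁,
      fun i hi => (r₂ i hi).trans (r₁ i hi), ?_, ?_⟩
    · simp only [hpos, if_true, v₂, a₁, hv]
    · refine add_le_add_two_pow c₁ (add_le_add_two_pow (le_add_two_pow B 2) ?_)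
      exact c₂.trans (Nat.pow_le_pow_right (by omega) (by omega))
  · obtain ⟨s₂, l, e₂, a₂, r₂, v₂, c₂⟩ := hq' s₁ B (by rwa [a₁])
    refine ⟨_, _, .seq e₁ (.iteFalse (by simpa [Expr.eval, v₁] using hpos) e₂), a₂.trans a₁,
      fun i hi => (r₂ i hi).trans (r₁ i hi), ?_, ?_⟩
    · simp only [hpos, if_false, v₂, a₁, hv]
    · refine add_le_add_two_pow c₁ (add_le_add_two_pow (le_add_two_pow B 2) ?_)
      exact c₂.trans (Nat.pow_le_pow_right (by omega) (by omega))

/-! ### Bounded loops and sums -/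

/-- The sum of `f z` over all `z < N`. -/
def BSum (N : ℕ) (f : ℤ → ℤ) : ℤ := ∑ z ∈ Finset.range N, f z

/-- `P z` holds for all `z < N`. -/
def BAll (N : ℕ) (P : ℤ → Prop) : Prop := ∀ z : ℕ, z < N → P z

/-- `P z` holds for some `z < N`. -/
def BEx (N : ℕ) (P : ℤ → Prop) : Prop := ∃ z : ℕ, z < N ∧ P z

/-- A counting loop: if from every state satisfying `I z` the body `p` leads within `C` steps to a
state satisfying `I (z + 1)`, then `N` rounds lead from `I 0` to `I N`. -/
theorem exec_while {e : Expr} {p : Prog} (I : ℕ → State → Prop) (N C D : ℕ)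
    (hpos : ∀ z s, I z s → (0 < e.eval s ↔ z < N)) (hcost : e.cost + 1 ≤ D)
    (hp : ∀ z s, z < N → I z s → ∃ s' k, Exec p s k s' ∧ I (z + 1) s' ∧ k ≤ C)
    {s : State} (hs : I 0 s) :
    ∃ s' k, Exec (.while e p) s k s' ∧ I N s' ∧ k ≤ N * (C + D) + D := by
  suffices H : ∀ m z s, z + m = N → I z s →
      ∃ s' k, Exec (.while e p) s k s' ∧ I N s' ∧ k ≤ m * (C + D) + D from H N 0 s (by omega) hs
  intro m
  induction m with
  | zero =>
    intro z s hz hI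
    obtain rfl : z = N := by omega
    exact ⟨s, _, .whileFalse (by simp [hpos z s hI]), hI, by omega⟩
  | succ m ih =>
    intro z s hz hI
    obtain ⟨s₁, k, e₁, h₁, hk⟩ := hp z s (by omega) hI
    obtain ⟨s₂, l, e₂, h₂, hl⟩ := ih (z + 1) s₁ (by omega) h₁
    refine ⟨s₂, _, .whileTrue ((hpos z s hI).2 (by omega)) e₁ e₂, h₂, ?_⟩
    have : (m + 1) * (C + D) = m * (C + D) + (C + D) := by ring
    omega

/-- Register `r` accumulates the sum, `r + 1` is the counter and doubles as the bound variable, and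
the summand is computed in `r + 2`. The number of rounds is an entry of array `9`, hence at most
`B`. -/
theorem PComp.sum (j : ℤ) {f : Arr → (ℕ → ℤ) → ℤ → ℤ}
    (hf : PComp fun A v => f A (fun k => v (k + 1)) (v 0)) :
    PComp (fun A v => BSum (A 9 j).toNat (fun z => f A v z)) := by
  obtain ⟨c, hf⟩ := hf
  refine ⟨c + 30, fun ρ r hρ => ?_⟩
  obtain ⟨p, hp⟩ := hf (fun k => Nat.casesOn k (r + 1) ρ) (r + 2) (by
    rintro (_ | k)
    · exact Nat.lt_succ_self (r + 1)
    · exact (hρ k).trans (by omega))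
  refine ⟨.seq (.seq (.assign r (.lit 0)) (.assign (r + 1) (.lit 0)))
    (.while (.sub (.get 9 (.lit j)) (.reg (r + 1)))
      (.seq p (.seq (.assign r (.add (.reg r) (.reg (r + 2))))
        (.assign (r + 1) (.add (.reg (r + 1)) (.lit 1)))))), fun s B hB => ?_⟩
  let v : ℕ → ℤ := fun i => s.reg (ρ i)
  let I : ℕ → State → Prop := fun z s' => s'.arr = s.arr ∧ (∀ i < r, s'.reg i = s.reg i) ∧
    s'.reg r = BSum z (fun z => f s.arr v z) ∧ s'.reg (r + 1) = z
  obtain ⟨s', k, e, ⟨ia, ir, iv, iz⟩, hk⟩ := exec_while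
    (e := .sub (.get 9 (.lit j)) (.reg (r + 1)))
    (p := .seq p (.seq (.assign r (.add (.reg r) (.reg (r + 2))))
        (.assign (r + 1) (.add (.reg (r + 1)) (.lit 1)))))
    I (s.arr 9 j).toNat ((B + 2) ^ c + 8) 5
    (s := ⟨Function.update (Function.update s.reg r 0) (r + 1) 0, s.arr⟩)
    (by
      rintro z s₀ ⟨ia, ir, iv, iz⟩
      simp only [Expr.eval, ia, iz]
      omega)
    (by simp [Expr.cost])
    (by
      rintro z s₀ - ⟨ia, ir, iv, iz⟩
      obtain ⟨s₁, k, e₁, a₁, r₁, v₁, c₁⟩ := hp s₀ B (by rwa [ia])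
      refine ⟨_, _, .seq e₁ (.seq (.assign _ _ _) (.assign _ _ _)), ⟨a₁.trans ia, ?_, ?_, ?_⟩, ?_⟩
      · intro i hi
        have h1 : i ≠ r := by omega
        have h2 : i ≠ r + 1 := by omega
        simp [Function.update_of_ne h1, Function.update_of_ne h2, r₁ i (by omega), ir i hi]
      · have hval : s₁.reg (r + 2) = f s.arr v z := by
          rw [v₁, ia]
          change f s.arr (fun k => s₀.reg (ρ k)) (s₀.reg (r + 1)) = _
          rw [iz]
          congr 1
          funext k
          exact ir _ (hρ k)
        simp [Expr.eval, hval, r₁ r (by omega), iv, BSum, Finset.sum_range_succ]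
      · simp [Expr.eval, r₁ (r + 1) (by omega), iz]
      · simp only [Expr.cost]
        omega)
    (by
      refine ⟨rfl, ?_, ?_, ?_⟩
      · intro i hi
        have h1 : i ≠ r := by omega
        have h2 : i ≠ r + 1 := by omega
        simp [Function.update_of_ne h1, Function.update_of_ne h2]
      · simp [BSum]
      · simp)
  refine ⟨s', _, .seq (.seq (.assign _ _ _) (.assign _ _ _)) e, ia, ir, iv, ?_⟩
  have h9 : (s.arr 9 j).toNat ≤ (B + 2) ^ 1 := by
    have := hB j
    rw [pow_one]
    omega
  have hC := add_le_add_two_pow (add_le_add_two_pow (le_refl ((B + 2) ^ c))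
    (le_add_two_pow B 8)) (le_add_two_pow B 5)
  have h := add_le_add_two_pow (le_add_two_pow B 4)
    (hk.trans (add_le_add_two_pow (mul_le_add_two_pow h9 hC) (le_add_two_pow B 5)))
  exact h.trans (Nat.pow_le_pow_right (by omega) (by omega))

/-! ### Decidable predicates -/

open Classical in
/-- The predicate `P` is decidable by a computable function. -/
def PDec (P : Arr → (ℕ → ℤ) → Prop) : Prop := PComp (fun A v => if P A v then 1 else 0)

theorem PDec.pos {f : Arr → (ℕ → ℤ) → ℤ} (hf : PComp f) : PDec (fun A v => 0 < f A v) := by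
  unfold PDec
  convert hf.itePos (PComp.const 1) (PComp.const 0) using 3
  simp

theorem PComp.ite {P : Arr → (ℕ → ℤ) → Prop} {dec : ∀ A v, Decidable (P A v)}
    {g h : Arr → (ℕ → ℤ) → ℤ} (hP : PDec P) (hg : PComp g) (hh : PComp h) :
    PComp (fun A v => if P A v then g A v else h A v) := by
  convert PComp.itePos hP hg hh using 4 with A v
  by_cases hPv : P A v <;> simp [hPv]

theorem PDec.congr {P Q : Arr → (ℕ → ℤ) → Prop} (hP : PDec P) (h : ∀ A v, P A v ↔ Q A v) :
    PDec Q := by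
  have : P = Q := by
    funext A v
    exact propext (h A v)
  exact this ▸ hP

theorem PDec.lt {f g : Arr → (ℕ → ℤ) → ℤ} (hf : PComp f) (hg : PComp g) :
    PDec (fun A v => f A v < g A v) :=
  (PDec.pos (hg.sub hf)).congr fun _ _ => sub_pos

theorem PDec.not {P : Arr → (ℕ → ℤ) → Prop} (hP : PDec P) : PDec (fun A v => ¬ P A v) := by
  have h := PDec.pos (PComp.ite (dec := fun _ _ => Classical.dec _) hP (PComp.const 0) (PComp.const 1))
  refine h.congr fun A v => ?_
  by_cases hPv : P A v <;> simp [hPv]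

theorem PDec.le {f g : Arr → (ℕ → ℤ) → ℤ} (hf : PComp f) (hg : PComp g) :
    PDec (fun A v => f A v ≤ g A v) :=
  (PDec.lt hg hf).not.congr fun _ _ => not_lt

theorem PDec.and {P Q : Arr → (ℕ → ℤ) → Prop} (hP : PDec P) (hQ : PDec Q) :
    PDec (fun A v => P A v ∧ Q A v) := by
  have h := PDec.pos (PComp.ite (dec := fun _ _ => Classical.dec _) hP
    (PComp.ite (dec := fun _ _ => Classical.dec _) hQ (PComp.const 1) (PComp.const 0))
    (PComp.const 0))
  refine h.congr fun A v => ?_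
  by_cases hPv : P A v <;> by_cases hQv : Q A v <;> simp [hPv, hQv]

theorem PDec.or {P Q : Arr → (ℕ → ℤ) → Prop} (hP : PDec P) (hQ : PDec Q) :
    PDec (fun A v => P A v ∨ Q A v) :=
  (hP.not.and hQ.not).not.congr fun A v => by tauto

theorem PDec.imp {P Q : Arr → (ℕ → ℤ) → Prop} (hP : PDec P) (hQ : PDec Q) :
    PDec (fun A v => P A v → Q A v) :=
  (hP.not.or hQ).congr fun A v => by tauto

theorem PDec.eq {f g : Arr → (ℕ → ℤ) → ℤ} (hf : PComp f) (hg : PComp g) :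
    PDec (fun A v => f A v = g A v) :=
  ((PDec.le hf hg).and (PDec.le hg hf)).congr fun _ _ => le_antisymm_iff.symm

theorem PDec.ne {f g : Arr → (ℕ → ℤ) → ℤ} (hf : PComp f) (hg : PComp g) :
    PDec (fun A v => f A v ≠ g A v) := (PDec.eq hf hg).not

/-- A witness exists exactly when the number of witnesses, a bounded sum, is positive. -/
theorem PDec.ex (j : ℤ) {P : Arr → (ℕ → ℤ) → ℤ → Prop}
    (hP : PDec fun A v => P A (fun k => v (k + 1)) (v 0)) :
    PDec (fun A v => BEx (A 9 j).toNat (fun z => P A v z)) := by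
  classical
  have h := PDec.pos (PComp.sum j (f := fun A v z => if P A v z then 1 else 0) hP)
  refine h.congr fun A v => ?_
  unfold BSum BEx
  rw [Finset.sum_pos_iff_of_nonneg (by intros; dsimp only; split_ifs <;> simp)]
  constructor
  · rintro ⟨z, hz, h⟩
    refine ⟨z, Finset.mem_range.1 hz, ?_⟩
    by_contra hn
    simp [hn] at h
  · rintro ⟨z, hz, h⟩
    exact ⟨z, Finset.mem_range.2 hz, by simp [h]⟩

theorem PDec.all (j : ℤ) {P : Arr → (ℕ → ℤ) → ℤ → Prop}
    (hP : PDec fun A v => P A (fun k => v (k + 1)) (v 0)) :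
    PDec (fun A v => BAll (A 9 j).toNat (fun z => P A v z)) := by
  refine (PDec.ex j (P := fun A v z => ¬ P A v z) hP.not).not.congr fun A v => ?_
  simp [BEx, BAll]

theorem PDec.comp₂ {P : Arr → ℤ → ℤ → Prop} (hP : PDec fun A v => P A (v 0) (v 1))
    {f g : Arr → (ℕ → ℤ) → ℤ} (hf : PComp f) (hg : PComp g) :
    PDec (fun A v => P A (f A v) (g A v)) := by
  classical exact PComp.comp₂ (F := fun A x y => if P A x y then 1 else 0) hP hf hg

theorem PComp.max {f g : Arr → (ℕ → ℤ) → ℤ} (hf : PComp f) (hg : PComp g) :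
    PComp (fun A v => max (f A v) (g A v)) := by
  convert PComp.ite (dec := fun _ _ => inferInstance) (PDec.le hf hg) hg hf using 3
  exact max_def _ _

/-! ### Search and minimization -/

open Classical in
/-- The least `z < N` with `P z`, or `N` if there is none. -/
noncomputable def findFirst (N : ℕ) (P : ℤ → Prop) : ℤ :=
  BSum N (fun z => if BEx N (fun y => y ≤ z ∧ P y) then 0 else 1)

theorem PComp.findFirst (j : ℤ) {P : Arr → (ℕ → ℤ) → ℤ → Prop}
    (hP : PDec fun A v => P A (fun k => v (k + 1)) (v 0)) :
    PComp (fun A v => findFirst (A 9 j).toNat (fun z => P A v z)) := by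
  unfold PartialIncentives.findFirst
  refine PComp.sum j (f := fun A v z => _) (PComp.ite ?_ (PComp.const 0) (PComp.const 1))
  refine PDec.ex j (P := fun A v y => y ≤ v 0 ∧ P A (fun k => v (k + 1)) y)
    ((PDec.le (PComp.var 0) (PComp.var 1)).and ?_)
  -- Variable `1` holds the outer candidate `z`, which `P` does not see.
  exact PComp.rename hP (fun k => if k = 0 then 0 else k + 1)

/-- The summand is `1` strictly before the first witness and `0` from there on, so the sum counts up
to that witness. -/
theorem findFirst_eq {N z : ℕ} {P : ℤ → Prop} (hz : z < N) (hP : P z)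
    (hmin : ∀ y : ℕ, y < z → ¬ P y) : findFirst N P = z := by
  classical
  simp only [findFirst, BSum]
  have : ∀ x ∈ Finset.range N, (if BEx N (fun y => y ≤ (x : ℤ) ∧ P y) then (0 : ℤ) else 1) =
      if x < z then 1 else 0 := by
    intro x _
    by_cases hx : x < z
    · rw [if_neg, if_pos hx]
      rintro ⟨y, _, hy, h⟩
      exact hmin y (by omega) h
    · rw [if_pos ⟨z, hz, by omega, hP⟩, if_neg hx]
  rw [Finset.sum_congr rfl this, Finset.sum_ite, Finset.sum_const_zero, add_zero, Finset.sum_const]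
  have : Finset.filter (fun x => x < z) (Finset.range N) = Finset.range z := by
    ext x
    simp only [Finset.mem_filter, Finset.mem_range]
    omega
  simp [this]

theorem findFirst_eq_bound {N : ℕ} {P : ℤ → Prop} (h : ∀ y : ℕ, y < N → ¬ P y) :
    findFirst N P = N := by
  classical
  simp only [findFirst, BSum]
  rw [Finset.sum_congr rfl (g := fun _ => 1)]
  · simp
  · intro x _
    rw [if_neg]
    rintro ⟨y, hy, _, h'⟩
    exact h y hy h'

theorem findFirst_spec {N : ℕ} {P : ℤ → Prop} (h : ∃ y : ℕ, y < N ∧ P y) :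
    ∃ z : ℕ, z < N ∧ findFirst N P = z ∧ P z ∧ ∀ y : ℕ, y < z → ¬ P y := by
  classical
  have hs := Nat.find_spec h
  have hm : ∀ y : ℕ, y < Nat.find h → ¬ P y := fun y hy hP =>
    Nat.find_min h hy ⟨hy.trans hs.1, hP⟩
  exact ⟨Nat.find h, hs.1, findFirst_eq hs.1 hs.2 hm, hs.2, hm⟩

/-- The least `z < N` that minimizes `f`. -/
noncomputable def argmin (N : ℕ) (f : ℤ → ℤ) : ℤ := findFirst N (fun z => BAll N (fun y => f z ≤ f y))

theorem argmin_spec {N : ℕ} (hN : 0 < N) (f : ℤ → ℤ) :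
    ∃ z : ℕ, z < N ∧ argmin N f = z ∧ ∀ y : ℕ, y < N → f z ≤ f y := by
  have : ∃ z : ℕ, z < N ∧ BAll N (fun y => f z ≤ f y) := by
    obtain ⟨z, hz, h⟩ := Finset.exists_min_image (Finset.range N) (fun z : ℕ => f z) ⟨0, by simpa⟩
    exact ⟨z, Finset.mem_range.1 hz, fun y hy => h y (Finset.mem_range.2 hy)⟩
  obtain ⟨z, hz, h, hP, _⟩ := findFirst_spec (P := fun z => BAll N (fun y => f z ≤ f y)) this
  exact ⟨z, hz, h, hP⟩

theorem PComp.argmin (j : ℤ) {f : Arr → (ℕ → ℤ) → ℤ → ℤ}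
    (hf : PComp fun A v => f A (fun k => v (k + 1)) (v 0)) :
    PComp (fun A v => argmin (A 9 j).toNat (fun z => f A v z)) := by
  unfold PartialIncentives.argmin
  refine PComp.findFirst j (P := fun A v z => _) ?_
  refine PDec.all j (P := fun A v y => f A (fun k => v (k + 1)) (v 0) ≤ f A (fun k => v (k + 1)) y)
    (PDec.le (hf.rename Nat.succ) (hf.rename fun k => if k = 0 then 0 else k + 1))

/-! ### Stages -/

/-- `F` is computable as a transformation of the arrays. -/
def PStage (F : Arr → Arr) : Prop :=
  ∃ (p : Prog) (c : ℕ), ∀ (s : State) (B : ℕ), LoopBounded B s.arr →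
    ∃ (s' : State) (k : ℕ), Exec p s k s' ∧ s'.arr = F s.arr ∧ k ≤ (B + 2) ^ c

/-- Set the loop bound with index `j`. -/
def setBound (j : ℤ) (f : Arr → ℤ) (A : Arr) : Arr :=
  Function.update A 9 (Function.update (A 9) j (f A))

theorem PStage.setBound (j : ℤ) {f : Arr → ℤ} (hf : PComp fun A _ => f A) :
    PStage (setBound j f) := by
  obtain ⟨c, hf⟩ := hf
  obtain ⟨p, hp⟩ := hf (fun _ => 0) 1 (fun _ => one_pos)
  refine ⟨.seq p (.put 9 (.lit j) (.reg 1)), c + 3 + 1, fun s B hB => ?_⟩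
  obtain ⟨s₁, k, e₁, a₁, -, v₁, c₁⟩ := hp s B hB
  refine ⟨_, _, .seq e₁ (.put _ _ _ _), ?_, add_le_add_two_pow c₁ (le_add_two_pow B 3)⟩
  simp only [Expr.eval, a₁, v₁, PartialIncentives.setBound]

/-- The first `N` rounds of filling array `a` by the recursion `f`. -/
def fill (a : ℕ) (f : Arr → ℤ → ℤ) (A : Arr) : ℕ → Arr
  | 0 => A
  | N + 1 => Function.update (fill a f A N) a
      (Function.update (fill a f A N a) N (f (fill a f A N) N))

theorem fill_of_ne {a b : ℕ} (h : b ≠ a) (f : Arr → ℤ → ℤ) (A : Arr) (N : ℕ) :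
    fill a f A N b = A b := by
  induction N with
  | zero => rfl
  | succ N ih => simp [fill, Function.update_of_ne h, ih]

/-- Round `m` writes at index `m` only, so entries below `z` are final after `z` rounds. -/
theorem fill_stable (a : ℕ) (f : Arr → ℤ → ℤ) (A : Arr) {y z N : ℕ} (hy : y < z) (hz : z ≤ N) :
    fill a f A N a y = fill a f A z a y := by
  induction N, hz using Nat.le_induction with
  | base => rfl
  | succ N hN ih =>
    have : (y : ℤ) ≠ N := by omega
    simp [fill, Function.update_of_ne this, ih]

theorem fill_apply (a : ℕ) (f : Arr → ℤ → ℤ) (A : Arr) {z N : ℕ} (hz : z < N) :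
    fill a f A N a z = f (fill a f A z) z := by
  rw [fill_stable a f A (Nat.lt_succ_self z) hz]
  simp [fill]

/-- Fill the entries of array `a` below the `j`-th loop bound by the recursion `f`. -/
def tabulate (a : ℕ) (j : ℤ) (f : Arr → ℤ → ℤ) (A : Arr) : Arr := fill a f A (A 9 j).toNat

theorem tabulate_of_ne {a b : ℕ} (h : b ≠ a) (j : ℤ) (f : Arr → ℤ → ℤ) (A : Arr) :
    tabulate a j f A b = A b := fill_of_ne h f A _

/-- Here `A'` is the memory just before round `z`. This form turns a recursive filling rule into an
equation for the finished table, provided the rule reads only earlier entries. -/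
theorem tabulate_apply (a : ℕ) (j : ℤ) (f : Arr → ℤ → ℤ) (A : Arr) {z : ℕ} (hz : z < A 9 j) :
    ∃ A' : Arr, (∀ b, b ≠ a → A' b = A b) ∧ (∀ y : ℕ, y < z → A' a y = tabulate a j f A a y) ∧
      tabulate a j f A a z = f A' z :=
  ⟨fill a f A z, fun _ hb => fill_of_ne hb f A z,
    fun y hy => (fill_stable a f A hy (by omega)).symm, fill_apply a f A (by omega)⟩

/-- The condition `a ≠ 9` keeps the loop bounds fixed while the loop runs. -/
theorem PStage.tabulate (a : ℕ) (j : ℤ) (ha : a ≠ 9) {f : Arr → ℤ → ℤ}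
    (hf : PComp fun A v => f A (v 0)) : PStage (tabulate a j f) := by
  obtain ⟨c, hf⟩ := hf
  obtain ⟨p, hp⟩ := hf (fun _ => 0) 1 (fun _ => one_pos)
  refine ⟨.seq (.assign 0 (.lit 0)) (.while (.sub (.get 9 (.lit j)) (.reg 0))
    (.seq p (.seq (.put a (.reg 0) (.reg 1)) (.assign 0 (.add (.reg 0) (.lit 1)))))),
    c + 30, fun s B hB => ?_⟩
  let I : ℕ → State → Prop := fun z s' => s'.arr = fill a f s.arr z ∧ s'.reg 0 = z
  obtain ⟨s', k, e, ⟨ia, -⟩, hk⟩ := exec_while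
    (e := .sub (.get 9 (.lit j)) (.reg 0))
    (p := .seq p (.seq (.put a (.reg 0) (.reg 1)) (.assign 0 (.add (.reg 0) (.lit 1)))))
    I (s.arr 9 j).toNat ((B + 2) ^ c + 8) 5 (s := ⟨Function.update s.reg 0 0, s.arr⟩)
    (by
      rintro z s₀ ⟨ia, iz⟩
      simp only [Expr.eval, ia, iz, fill_of_ne ha.symm]
      omega)
    (by simp [Expr.cost])
    (by
      rintro z s₀ - ⟨ia, iz⟩
      obtain ⟨s₁, k, e₁, a₁, r₁, v₁, c₁⟩ := hp s₀ B (by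
        intro i
        rw [ia, fill_of_ne ha.symm]
        exact hB i)
      refine ⟨_, _, .seq e₁ (.seq (.put _ _ _ _) (.assign _ _ _)), ⟨?_, ?_⟩, ?_⟩
      · simp [Expr.eval, a₁, ia, v₁, r₁ 0 one_pos, iz, fill]
      · simp [Expr.eval, r₁ 0 one_pos, iz]
      · simp only [Expr.cost]
        omega)
    ⟨rfl, by simp⟩
  refine ⟨s', _, .seq (.assign _ _ _) e, ia, ?_⟩
  have h9 : (s.arr 9 j).toNat ≤ (B + 2) ^ 1 := by
    have := hB j
    rw [pow_one]
    omega
  have hC := add_le_add_two_pow (add_le_add_two_pow (le_refl ((B + 2) ^ c))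
    (le_add_two_pow B 8)) (le_add_two_pow B 5)
  have h := add_le_add_two_pow (le_add_two_pow B 2)
    (hk.trans (add_le_add_two_pow (mul_le_add_two_pow h9 hC) (le_add_two_pow B 5)))
  exact h.trans (Nat.pow_le_pow_right (by omega) (by omega))

/-! ## Partial incentives as solutions of a constraint problem -/

/-- In the list `w 0, …, w (T - 1)` the entry `a` occurs before any occurrence of `b`. -/
def Before (T : ℤ) (w : ℤ → ℤ) (a b : ℤ) : Prop :=
  BEx T.toNat fun j => w j = a ∧ BAll T.toNat fun j' => j' ≤ j → w j' ≠ b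

/-- `a` is a neighbor of `i` that comes later in the elimination ordering. -/
def InSep (adj : ℤ → ℤ → Prop) (i a : ℤ) : Prop := i < a ∧ adj i a

/-- The bag of `i` consists of `i` and its later neighbors. -/
def InBag (adj : ℤ → ℤ → Prop) (i a : ℤ) : Prop := a = i ∨ InSep adj i a

/-- `e` describes a local schedule for the bag of `i`: `e j 0` is the `j`-th vertex of the bag to be
reached, and `e j 1, …, e j T` are neighbors that support it; entries that are not less than `N`
are void. -/
def Valid (N T : ℤ) (adj : ℤ → ℤ → Prop) (i : ℤ) (e : ℤ → ℤ → ℤ) : Prop :=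
  (BAll T.toNat fun j => e j 0 < N → InBag adj i (e j 0)) ∧
  (BAll T.toNat fun j => e j 0 < N → BAll T.toNat fun j' => j < j' → e j 0 ≠ e j' 0) ∧
  (BAll N.toNat fun a => InBag adj i a →
    (BEx T.toNat fun j => e j 0 = a) ∨ BAll T.toNat fun j => e j 0 < N) ∧
  BAll T.toNat fun j => e j 0 < N → BAll T.toNat fun k => e j (k + 1) < N →
    adj (e j 0) (e j (k + 1)) ∧
    (BAll T.toNat fun k' => k < k' → e j (k + 1) ≠ e j (k' + 1)) ∧
    (InBag adj i (e j (k + 1)) → Before T (fun j' => e j' 0) (e j (k + 1)) (e j 0))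

/-- The local schedules `e` and `e'` agree on the later neighbors of `i`. -/
def Compat (N T : ℤ) (adj : ℤ → ℤ → Prop) (i : ℤ) (e e' : ℤ → ℤ → ℤ) : Prop :=
  (BAll N.toNat fun a => InSep adj i a → BAll N.toNat fun b => InSep adj i b →
    Before T (fun j => e j 0) a b → ¬ Before T (fun j => e' j 0) b a) ∧
  (BAll N.toNat fun a => InSep adj i a → BAll T.toNat fun j => e j 0 = a →
    BAll T.toNat fun j' => e' j' 0 = a → BAll T.toNat fun k => e j (k + 1) = e' j' (k + 1))

/-- The number of supporters in the `j`-th entry. -/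
def supporters (N T : ℤ) (e : ℤ → ℤ → ℤ) (j : ℤ) : ℤ :=
  BSum T.toNat fun k => if e j (k + 1) < N then 1 else 0

/-- The incentive that a vertex `i` of threshold `τ` needs under the local schedule `e`. -/
def incentive (N T τ i : ℤ) (e : ℤ → ℤ → ℤ) : ℤ :=
  BSum T.toNat fun j => if e j 0 = i then max 0 (τ - supporters N T e j) else 0

theorem isPartialIncentive_iff {V : Type*} (G : SimpleGraph V) (τ : V → ℤ) (σ : V → ℕ) :
    IsPartialIncentive G τ σ ↔
      ∀ H, IsHullClosed G (fun u => τ u - (σ u : ℤ)) H → ∀ u, u ∈ H := by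
  unfold IsPartialIncentive hull
  simp [Set.eq_univ_iff_forall]
  exact ⟨fun h H hH u => h u H hH, fun h u H hH => h H hH u⟩

/-! ### Perfect elimination orderings and the forest of bags -/

/-- The vertices are numbered along a perfect elimination ordering. -/
def IsPEO {n : ℕ} (G : SimpleGraph (Fin n)) : Prop :=
  ∀ i a b : Fin n, i < a → i < b → a ≠ b → G.Adj i a → G.Adj i b → G.Adj a b

/-- `q` is the first later neighbor of `i`. -/
def IsParent {n : ℕ} (G : SimpleGraph (Fin n)) (i q : Fin n) : Prop :=
  i < q ∧ G.Adj i q ∧ ∀ b, i < b → G.Adj i b → q ≤ b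

theorem exists_isParent {n : ℕ} (G : SimpleGraph (Fin n)) {i a : Fin n} (h : i < a)
    (ha : G.Adj i a) : ∃ q, IsParent G i q := by
  classical
  obtain ⟨q, hq, hmin⟩ := Finset.exists_min_image (Finset.univ.filter fun a => i < a ∧ G.Adj i a) id
    ⟨a, by simp [h, ha]⟩
  simp only [Finset.mem_filter, Finset.mem_univ, true_and, id] at hq hmin
  exact ⟨q, hq.1, hq.2, fun b hb hb' => hmin b ⟨hb, hb'⟩⟩

/-- The later neighbors of `i` form a clique and `q` is the first of them, so all of them lie in the
bag of `q`. This is the running intersection property that lets constraints be checked between a bag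
and its parent only. -/
theorem IsParent.mem {n : ℕ} {G : SimpleGraph (Fin n)} (hG : IsPEO G) {i q a : Fin n}
    (hq : IsParent G i q) (h : i < a) (ha : G.Adj i a) : a = q ∨ (q < a ∧ G.Adj q a) := by
  rcases (hq.2.2 a h ha).eq_or_lt with h' | h'
  · exact .inl h'.symm
  · exact .inr ⟨h', hG i q a hq.1 h h'.ne hq.2.1 ha⟩

theorem exists_fin_cast {n : ℕ} {z : ℤ} (h0 : 0 ≤ z) (h : z < n) : ∃ u : Fin n, ((u : ℕ) : ℤ) = z :=
  ⟨⟨z.toNat, by omega⟩, by simpa using h0⟩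

theorem fin_cast_inj {n : ℕ} {u v : Fin n} : ((u : ℕ) : ℤ) = ((v : ℕ) : ℤ) ↔ u = v := by
  rw [Nat.cast_inj, Fin.val_inj]

/-! ### Compatible local schedules give a partial incentive -/

section Soundness

variable {n t : ℕ} {G : SimpleGraph (Fin n)} {adj : ℤ → ℤ → Prop} {E : Fin n → ℤ → ℤ → ℤ}
  {H : Set (Fin n)}

/-- In slot `j` of the schedule of `i` there is the vertex `u`, which is the first one outside
of `H`. -/
def FirstOutside (E : Fin n → ℤ → ℤ → ℤ) (H : Set (Fin n)) (t : ℕ) (i u : Fin n) (j : ℕ) : Prop :=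
  j < t ∧ E i j 0 = (u : ℕ) ∧ u ∉ H ∧ ∀ j' < j, ∀ v : Fin n, E i j' 0 = (v : ℕ) → v ∈ H

theorem FirstOutside.before {i u v : Fin n} {j : ℕ} (h : FirstOutside E H t i u j) (hv : v ∉ H)
    (huv : v ≠ u) : Before t (fun j => E i j 0) (u : ℕ) (v : ℕ) := by
  refine ⟨j, by simpa using h.1, h.2.1, fun j' hj' hle heq => ?_⟩
  rcases (show j' ≤ j by exact_mod_cast hle).eq_or_lt with rfl | hlt
  · exact huv (fin_cast_inj.1 (heq.symm.trans h.2.1))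
  · exact hv (h.2.2.2 j' hlt v heq)

theorem FirstOutside.mem_of_before {i u v : Fin n} {j : ℕ} (h : FirstOutside E H t i u j)
    (hv : Before t (fun j => E i j 0) (v : ℕ) (u : ℕ)) : v ∈ H := by
  obtain ⟨l, hl, hlv, hl'⟩ := hv
  refine h.2.2.2 l ?_ v hlv
  by_contra hlt
  exact hl' j (by simpa using h.1) (by omega) h.2.1

theorem inBag_clique (hG : IsPEO G) (hadj : ∀ u v : Fin n, adj (u : ℕ) (v : ℕ) ↔ G.Adj u v)
    {i a b : Fin n} (ha : InBag adj (i : ℕ) (a : ℕ)) (hb : InBag adj (i : ℕ) (b : ℕ)) (hab : a ≠ b) :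
    G.Adj a b := by
  simp only [InBag, InSep, hadj, fin_cast_inj, Nat.cast_lt, Fin.val_fin_lt] at ha hb
  rcases ha with rfl | ha <;> rcases hb with rfl | hb
  · exact (hab rfl).elim
  · exact hb.2
  · exact ha.2.symm
  · exact hG i a b ha.1 hb.1 hab ha.2 hb.2

/-- A bag vertex `a` outside `H` is either listed itself, or the list is full. If a full list lay
inside `H`, then `a` would have `t` neighbors in `H`, as the bag is a clique, and its threshold
would be met. -/
theorem exists_firstOutside (hG : IsPEO G)
    (hadj : ∀ u v : Fin n, adj (u : ℕ) (v : ℕ) ↔ G.Adj u v)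
    (hE : ∀ i, ∀ j k : ℕ, j < t → k ≤ t → 0 ≤ E i j k) {θ : Fin n → ℤ} (hθ : ∀ u, θ u ≤ t) (hH : IsHullClosed G θ H)
    {i : Fin n} (hval : Valid n t adj (i : ℕ) (E i)) {a : Fin n} (ha : InBag adj (i : ℕ) (a : ℕ))
    (haH : a ∉ H) : ∃ u j, FirstOutside E H t i u j ∧ InBag adj (i : ℕ) (u : ℕ) := by
  classical
  obtain ⟨hbag, hdist, hfull, -⟩ := hval
  simp only [Int.toNat_natCast] at hbag hdist hfull
  have hex : ∃ j : ℕ, j < t ∧ ∃ u : Fin n, E i j 0 = (u : ℕ) ∧ u ∉ H := by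
    rcases hfull a a.2 ha with ⟨j, hj, h⟩ | h
    · exact ⟨j, hj, a, h, haH⟩
    · by_contra hcon
      push Not at hcon
      have hc : ∀ j : Fin t, ∃ u : Fin n, E i (j : ℕ) 0 = (u : ℕ) := fun j => by
        obtain ⟨u, hu⟩ := exists_fin_cast (hE i j 0 j.2 (Nat.zero_le _)) (h j j.2)
        exact ⟨u, hu.symm⟩
      choose w hw using hc
      have hinj : Function.Injective w := by
        intro j j' hjj
        by_contra hne
        rcases lt_or_gt_of_ne (Fin.val_ne_of_ne hne) with hlt | hlt
        · exact hdist j j.2 (h j j.2) j' j'.2 (by exact_mod_cast hlt) (by rw [hw, hw, hjj])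
        · exact hdist j' j'.2 (h j' j'.2) j j.2 (by exact_mod_cast hlt) (by rw [hw, hw, hjj])
      refine haH (hH a ((hθ a).trans ?_))
      have hsub : Set.range w ⊆ H ∩ G.neighborSet a := by
        rintro _ ⟨j, rfl⟩
        have hwH := hcon j j.2 (w j) (hw j)
        refine ⟨hwH, inBag_clique hG hadj ha ?_ (fun h => haH (h ▸ hwH))⟩
        rw [← hw]
        exact hbag j j.2 (h j j.2)
      have := Set.ncard_le_ncard hsub (Set.toFinite _)
      rw [← Set.image_univ, Set.ncard_image_of_injective _ hinj, Set.ncard_univ,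
        Nat.card_eq_fintype_card, Fintype.card_fin] at this
      exact_mod_cast this
  obtain ⟨hj, u, hu, huH⟩ := Nat.find_spec hex
  refine ⟨u, Nat.find hex, ⟨hj, hu, huH, fun j' hj' v hv => ?_⟩, ?_⟩
  · by_contra hvH
    exact Nat.find_min hex hj' ⟨hj'.trans hj, v, hv, hvH⟩
  · rw [← hu]
    exact hbag _ hj (by rw [hu]; exact_mod_cast u.2)

/-- A compatible family of local schedules yields a partial incentive. -/
theorem isPartialIncentive_of_valid (hG : IsPEO G)
    (hadj : ∀ u v : Fin n, adj (u : ℕ) (v : ℕ) ↔ G.Adj u v)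
    (hE : ∀ i, ∀ j k : ℕ, j < t → k ≤ t → 0 ≤ E i j k) {τ : Fin n → ℤ} (hτ : ∀ u, τ u ≤ t)
    (hval : ∀ i : Fin n, Valid n t adj (i : ℕ) (E i))
    (hcomp : ∀ i q : Fin n, IsParent G i q → Compat n t adj (i : ℕ) (E i) (E q))
    {σ : Fin n → ℕ} (hσ : ∀ i : Fin n, incentive n t (τ i) (i : ℕ) (E i) ≤ σ i) :
    IsPartialIncentive G τ σ := by
  classical
  rw [isPartialIncentive_iff]
  intro H hH
  by_contra hne
  push Not at hne
  have hθ : ∀ u, τ u - (σ u : ℤ) ≤ t := fun u => by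
    have := hτ u
    omega
  have hfirst : ∀ {i a : Fin n}, InBag adj (i : ℕ) (a : ℕ) → a ∉ H →
      ∃ u j, FirstOutside E H t i u j ∧ InBag adj (i : ℕ) (u : ℕ) := fun {i a} ha haH =>
    exists_firstOutside hG hadj hE hθ hH (hval i) ha haH
  -- The largest vertex outside `H` works: all other members of its bag are later and thus lie in
  -- `H`.
  have hex : ∃ i : Fin n, ∃ j, FirstOutside E H t i i j := by
    obtain ⟨i, hi, hmax⟩ := Finset.exists_max_image (Finset.univ.filter fun u => u ∉ H) id
      (by obtain ⟨u, hu⟩ := hne; exact ⟨u, by simpa using hu⟩)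
    simp only [Finset.mem_filter, Finset.mem_univ, true_and, id] at hi hmax
    obtain ⟨u, j, hu, hb⟩ := hfirst (i := i) (a := i) (.inl rfl) hi
    rcases hb with h | h
    · rw [fin_cast_inj] at h
      exact ⟨i, j, h ▸ hu⟩
    · have := hmax u hu.2.2.1
      have h' := h.1
      rw [Nat.cast_lt, Fin.val_fin_lt] at h'
      exact absurd this (not_le.2 h')
  obtain ⟨i, ⟨j₀, hi⟩, hmin⟩ : ∃ i : Fin n, (∃ j, FirstOutside E H t i i j) ∧
      ∀ l < i, ¬ ∃ j, FirstOutside E H t l l j := by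
    obtain ⟨i, hi, hmin⟩ := Finset.exists_min_image
      (Finset.univ.filter fun i : Fin n => ∃ j, FirstOutside E H t i i j) id
      (by obtain ⟨u, hu⟩ := hex; exact ⟨u, by simpa using hu⟩)
    simp only [Finset.mem_filter, Finset.mem_univ, true_and, id] at hi hmin
    exact ⟨i, hi, fun l hl h => absurd (hmin l h) (not_le.2 hl)⟩
  have hiH := hi.2.2.1
  -- `i` is the first vertex outside of `H` in all bags that contain it
  have key : ∀ m : ℕ, ∀ l : Fin n, (i : ℕ) - l = m → InBag adj (l : ℕ) (i : ℕ) →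
      ∃ j, FirstOutside E H t l i j ∧
        ∀ k : ℕ, k < t → E l j ((k : ℤ) + 1) = E i j₀ ((k : ℤ) + 1) := by
    intro m
    induction m using Nat.strong_induction_on with
    | _ m ih =>
      intro l hl hmem
      rcases hmem with h | h
      · rw [fin_cast_inj] at h
        exact ⟨j₀, h ▸ hi, fun k _ => by rw [h]⟩
      have hsep := h
      obtain ⟨hlt, hla⟩ := h
      rw [Nat.cast_lt, Fin.val_fin_lt] at hlt
      rw [hadj] at hla
      obtain ⟨q, hq⟩ := exists_isParent G hlt hla
      have hqi : InBag adj (q : ℕ) (i : ℕ) := by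
        simp only [InBag, InSep, hadj, fin_cast_inj, Nat.cast_lt, Fin.val_fin_lt]
        exact hq.mem hG hlt hla
      have hlq : (l : ℕ) < q := hq.1
      have hqle : (q : ℕ) ≤ i := hq.2.2 i hlt hla
      obtain ⟨j', hj', hk'⟩ := ih _ (by omega) q rfl hqi
      obtain ⟨hord, hsup⟩ := hcomp l q hq
      simp only [Int.toNat_natCast] at hord hsup
      obtain ⟨u, j, hu, hub⟩ := hfirst (i := l) (a := i) (.inr hsep) hiH
      rcases hub with hul | hul
      -- The first outside vertex cannot be `l` itself, by minimality of `i`.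
      · rw [fin_cast_inj] at hul
        exact (hmin l hlt ⟨j, hul ▸ hu⟩).elim
      · obtain rfl : u = i := by
          -- Otherwise `u` comes before `i` in the bag of `l`, and `i` before `u` in the bag of the
          -- parent, which compatibility forbids.
          by_contra hne
          exact hord u u.2 hul i i.2 hsep (hu.before hiH (Ne.symm hne)) (hj'.before hu.2.2.1 hne)
        exact ⟨j, hu, fun k hk => (hsup u u.2 hsep j hu.1 hu.2.1 j' hj'.1 hj'.2.1 k hk).trans
          (hk' k hk)⟩
  obtain ⟨-, -, -, hsupp⟩ := hval i
  simp only [Int.toNat_natCast] at hsupp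
  have hin : E i j₀ 0 < n := by rw [hi.2.1]; exact_mod_cast i.2
  have hS := hsupp j₀ hi.1 hin
  rw [hi.2.1] at hS
  have hmemH : ∀ k : ℕ, k < t → ∀ s : Fin n, E i j₀ ((k : ℤ) + 1) = (s : ℕ) →
      s ∈ H ∩ G.neighborSet i := by
    intro k hk s hs
    have hsn : E i j₀ ((k : ℤ) + 1) < n := by rw [hs]; exact_mod_cast s.2
    obtain ⟨h1, -, h3⟩ := hS k hk hsn
    rw [hs] at h1 h3
    have hadjis : G.Adj i s := (hadj _ _).1 h1
    refine ⟨?_, hadjis⟩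
    -- A later supporter lies in the bag of `i`, where it is listed before `i`. For an earlier
    -- supporter `s`, the vertex `i` lies in the bag of `s` with the same supporters, and validity
    -- there puts `s` before `i`.
    rcases lt_or_gt_of_ne hadjis.ne with hlt | hlt
    · exact hi.mem_of_before (h3 (.inr ⟨by exact_mod_cast hlt, h1⟩))
    · have hmem : InBag adj (s : ℕ) (i : ℕ) :=
        .inr ⟨by exact_mod_cast hlt, (hadj _ _).2 hadjis.symm⟩
      obtain ⟨j, hj, hjk⟩ := key _ s rfl hmem
      obtain ⟨-, -, -, hsupp'⟩ := hval s
      simp only [Int.toNat_natCast] at hsupp'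
      obtain ⟨-, -, h⟩ := hsupp' j hj.1 (by rw [hj.2.1]; exact_mod_cast i.2) k hk
        (by rw [hjk k hk]; exact hsn)
      rw [hjk k hk, hs, hj.2.1] at h
      exact hj.mem_of_before (h (.inl rfl))
  refine hiH (hH i ?_)
  have hcard : supporters n t (E i) j₀ ≤ ((H ∩ G.neighborSet i).ncard : ℤ) := by
    unfold supporters BSum
    rw [Int.toNat_natCast, Finset.sum_boole, Nat.cast_le, ← Set.ncard_coe_finset]
    have hc : ∀ k ∈ ((Finset.range t).filter fun k : ℕ => E i j₀ ((k : ℤ) + 1) < n : Finset ℕ),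
        ∃ s : Fin n, E i j₀ ((k : ℤ) + 1) = (s : ℕ) := fun k hk => by
      obtain ⟨u, hu⟩ := exists_fin_cast
        (by simpa using hE i j₀ (k + 1) hi.1 (Finset.mem_range.1 (Finset.mem_filter.1 hk).1))
        (Finset.mem_filter.1 hk).2
      exact ⟨u, hu.symm⟩
    have : Nonempty (Fin n) := ⟨i⟩
    choose! w hw using hc
    refine Set.ncard_le_ncard_of_injOn w (fun k hk => ?_) (fun k hk k' hk' heq => ?_) (Set.toFinite _)
    · exact hmemH k (Finset.mem_range.1 (Finset.mem_filter.1 hk).1) _ (hw k hk)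
    · have h := hw k hk
      have h' := hw k' hk'
      rw [Finset.mem_coe, Finset.mem_filter, Finset.mem_range] at hk hk'
      by_contra hne
      rcases lt_or_gt_of_ne hne with hlt | hlt
      · exact (hS k hk.1 hk.2).2.1 k' hk'.1 (by exact_mod_cast hlt) (by rw [h, h', heq])
      · exact (hS k' hk'.1 hk'.2).2.1 k hk.1 (by exact_mod_cast hlt) (by rw [h, h', heq])
  have hle : τ i - supporters n t (E i) j₀ ≤ incentive n t (τ i) (i : ℕ) (E i) := by
    unfold incentive BSum
    refine le_trans ?_ (Finset.single_le_sum (s := Finset.range (t : ℤ).toNat) (a := j₀)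
      (f := fun j : ℕ => if E i j 0 = (i : ℕ) then max 0 (τ i - supporters n t (E i) j) else 0)
      (fun j _ => ?_) (by simpa using hi.1))
    · simp only [hi.2.1, if_true]
      exact le_max_right _ _
    · split_ifs
      · exact le_max_left _ _
      · exact le_rfl
  linarith [hσ i]

end Soundness

/-! ### From a partial incentive to local schedules -/

/-- A partial incentive reaches the vertices one by one, each having enough neighbors among the
vertices reached before. -/
theorem IsPartialIncentive.exists_rank {V : Type*} [Fintype V] {G : SimpleGraph V} {τ : V → ℤ}
    {σ : V → ℕ} (h : IsPartialIncentive G τ σ) :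
    ∃ ρ : V → ℕ, Function.Injective ρ ∧
      ∀ u, τ u - σ u ≤ ({v | G.Adj u v ∧ ρ v < ρ u}.ncard : ℤ) := by
  classical
  rw [isPartialIncentive_iff] at h
  -- A largest set that can be ordered this way is hull-closed, since otherwise a vertex could be
  -- appended with rank `s.card`.
  let P : Finset V → Prop := fun s => ∃ ρ : V → ℕ, Set.InjOn ρ s ∧ (∀ u ∈ s, ρ u < s.card) ∧
    ∀ u ∈ s, τ u - σ u ≤ ({v | v ∈ s ∧ G.Adj u v ∧ ρ v < ρ u}.ncard : ℤ)
  obtain ⟨s, hs, hmax⟩ := Finset.exists_max_image (Finset.univ.filter P) Finset.card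
    ⟨∅, by simpa using ⟨fun _ => 0, by simp⟩⟩
  simp only [Finset.mem_filter, Finset.mem_univ, true_and] at hs hmax
  obtain ⟨ρ, hinj, hlt, hρ⟩ := hs
  by_cases hclosed : IsHullClosed G (fun u => τ u - (σ u : ℤ)) (s : Set V)
  · have hall : ∀ u, u ∈ s := fun u => h _ hclosed u
    refine ⟨ρ, fun u v huv => hinj (hall u) (hall v) huv, fun u => ?_⟩
    convert hρ u (hall u) using 4
    simp [hall]
  · exfalso
    simp only [IsHullClosed, not_forall] at hclosed
    obtain ⟨u, hu, hus⟩ := hclosed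
    have hus' : u ∉ s := hus
    have hne : ∀ v ∈ s, v ≠ u := fun v hv h => hus' (h ▸ hv)
    have hPs : P (insert u s) := by
      refine ⟨Function.update ρ u s.card, ?_, ?_, ?_⟩
      · intro a ha b hb hab
        simp only [Finset.coe_insert, Set.mem_insert_iff, Finset.mem_coe] at ha hb
        rcases ha with rfl | ha <;> rcases hb with rfl | hb
        · rfl
        · rw [Function.update_self, Function.update_of_ne (hne b hb)] at hab
          have := hlt b hb
          omega
        · rw [Function.update_self, Function.update_of_ne (hne a ha)] at hab
          have := hlt a ha
          omega
        · rw [Function.update_of_ne (hne b hb), Function.update_of_ne (hne a ha)] at hab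
          exact hinj ha hb hab
      · intro a ha
        rw [Finset.card_insert_of_notMem hus']
        rcases Finset.mem_insert.1 ha with rfl | ha
        · simp
        · rw [Function.update_of_ne (hne a ha)]
          have := hlt a ha
          omega
      · intro a ha
        rcases Finset.mem_insert.1 ha with rfl | ha
        · refine hu.trans ?_
          rw [Nat.cast_le]
          refine Set.ncard_le_ncard ?_ (Set.toFinite _)
          rintro v ⟨hv, hav⟩
          refine ⟨Finset.mem_insert_of_mem hv, hav, ?_⟩
          rw [Function.update_self, Function.update_of_ne (hne v hv)]
          exact hlt v hv
        · refine (hρ a ha).trans ?_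
          rw [Nat.cast_le]
          refine Set.ncard_le_ncard ?_ (Set.toFinite _)
          rintro v ⟨hv, hav, hlt'⟩
          refine ⟨Finset.mem_insert_of_mem hv, hav, ?_⟩
          rwa [Function.update_of_ne (hne v hv), Function.update_of_ne (hne a ha)]
    have := hmax _ hPs
    rw [Finset.card_insert_of_notMem hus'] at this
    omega

section Completeness

variable {n t : ℕ} {G : SimpleGraph (Fin n)} {adj : ℤ → ℤ → Prop}

/-- The position of `a` in the set `S` with respect to the ranking `ρ`. -/
def position (ρ : Fin n → ℕ) (S : Finset (Fin n)) (a : Fin n) : ℕ :=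
  (S.filter fun b => ρ b < ρ a).card

theorem position_lt {ρ : Fin n → ℕ} {S : Finset (Fin n)} {a b : Fin n} (ha : a ∈ S)
    (h : ρ a < ρ b) : position ρ S a < position ρ S b := by
  refine Finset.card_lt_card ⟨?_, fun hsub => ?_⟩
  · intro c hc
    rw [Finset.mem_filter] at hc ⊢
    exact ⟨hc.1, hc.2.trans h⟩
  · have := hsub (Finset.mem_filter.2 ⟨ha, h⟩)
    simp at this

theorem position_injOn {ρ : Fin n → ℕ} (hρ : Function.Injective ρ) {S : Finset (Fin n)}
    {a b : Fin n} (ha : a ∈ S) (hb : b ∈ S) (h : position ρ S a = position ρ S b) : a = b := by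
  by_contra hne
  rcases lt_or_gt_of_ne (hρ.ne hne) with hlt | hlt
  · exact (position_lt ha hlt).ne h
  · exact (position_lt hb hlt).ne h.symm

/-- The members of `S` ranked below `a` have distinct positions below that of `a`, and there are as
many members as positions, so no position is skipped. -/
theorem exists_position_eq {ρ : Fin n → ℕ} (hρ : Function.Injective ρ) {S : Finset (Fin n)}
    {a : Fin n} {j : ℕ} (hj : j < position ρ S a) : ∃ b ∈ S, position ρ S b = j := by
  have himg : (S.filter fun b => ρ b < ρ a).image (position ρ S) = Finset.range (position ρ S a) := by
    refine Finset.eq_of_subset_of_card_le ?_ ?_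
    · intro k hk
      obtain ⟨b, hb, rfl⟩ := Finset.mem_image.1 hk
      rw [Finset.mem_filter] at hb
      exact Finset.mem_range.2 (position_lt hb.1 hb.2)
    · rw [Finset.card_range, Finset.card_image_of_injOn]
      · rfl
      · intro b hb c hc h
        rw [Finset.mem_coe, Finset.mem_filter] at hb hc
        exact position_injOn hρ hb.1 hc.1 h
  have := himg ▸ Finset.mem_range.2 hj
  obtain ⟨b, hb, h⟩ := Finset.mem_image.1 this
  exact ⟨b, (Finset.mem_filter.1 hb).1, h⟩

open Classical in
/-- The vertex at position `j` of `S`, if there is one. -/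
noncomputable def atPosition (ρ : Fin n → ℕ) (S : Finset (Fin n)) (j : ℕ) : Option (Fin n) :=
  if h : ∃ a ∈ S, position ρ S a = j then some h.choose else none

theorem atPosition_eq_some {ρ : Fin n → ℕ} (hρ : Function.Injective ρ) {S : Finset (Fin n)}
    {j : ℕ} {a : Fin n} : atPosition ρ S j = some a ↔ a ∈ S ∧ position ρ S a = j := by
  unfold atPosition
  split_ifs with h
  · rw [Option.some_inj]
    constructor
    · rintro rfl
      exact h.choose_spec
    · intro ha
      exact position_injOn hρ h.choose_spec.1 ha.1 (h.choose_spec.2.trans ha.2.symm)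
  · simp only [false_iff]
    exact fun ha => h ⟨a, ha⟩

/-- Vertices as numbers below `n`, where `n` stands for no vertex. -/
def code : Option (Fin n) → ℕ
  | none => n
  | some a => a

theorem code_eq {o : Option (Fin n)} {a : Fin n} : code o = (a : ℕ) ↔ o = some a := by
  cases o with
  | none =>
    have := a.2
    simp only [code, reduceCtorEq, iff_false]
    omega
  | some b => simp [code, Fin.val_inj]

theorem code_lt {o : Option (Fin n)} : code o < n ↔ ∃ a, o = some a := by
  cases o <;> simp [code]

theorem code_le (o : Option (Fin n)) : code o ≤ n := by
  cases o with
  | none => exact le_rfl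
  | some a => exact a.2.le

/-- Every partial incentive is induced by a compatible family of local schedules. -/
theorem IsPartialIncentive.exists_schedule (hG : IsPEO G)
    (hadj : ∀ u v : Fin n, adj (u : ℕ) (v : ℕ) ↔ G.Adj u v)
    {τ : Fin n → ℤ} (hτ : ∀ u, τ u ≤ t) {σ : Fin n → ℕ} (hσ : IsPartialIncentive G τ σ) :
    ∃ g : Fin n → ℕ → ℕ → ℕ, (∀ i j k, g i j k ≤ n) ∧
      ∀ E : Fin n → ℤ → ℤ → ℤ, (∀ i, ∀ j k : ℕ, j < t → k ≤ t → E i j k = g i j k) →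
        (∀ i : Fin n, Valid n t adj (i : ℕ) (E i)) ∧
        (∀ i q : Fin n, IsParent G i q → Compat n t adj (i : ℕ) (E i) (E q)) ∧
        ∀ i : Fin n, incentive n t (τ i) (i : ℕ) (E i) ≤ σ i := by
  classical
  obtain ⟨ρ, hinj, hρ⟩ := hσ.exists_rank
  let bag : Fin n → Finset (Fin n) := fun i => Finset.univ.filter fun a => a = i ∨ (i < a ∧ G.Adj i a)
  have hbag : ∀ i a : Fin n, InBag adj (i : ℕ) (a : ℕ) ↔ a ∈ bag i := by
    intro i a
    simp [InBag, InSep, hadj, bag, Fin.val_inj]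
  -- At most `t` earlier neighbors are kept as supporters; more are never needed because thresholds
  -- are at most `t`.
  have hsub : ∀ u, ∃ S : Finset (Fin n), S ⊆ (Finset.univ.filter fun v => G.Adj u v ∧ ρ v < ρ u) ∧
      S.card = min t (Finset.univ.filter fun v => G.Adj u v ∧ ρ v < ρ u).card := fun u =>
    Finset.exists_subset_card_eq (min_le_right _ _)
  choose S hS hcard using hsub
  -- The enumeration of supporters depends on the vertex and not on the bag, so different bags agree
  -- on it.
  let sup : Fin n → ℕ → Option (Fin n) := fun u k =>
    if h : k < (S u).card then some ((S u).equivFin.symm ⟨k, h⟩) else none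
  have hsup_mem : ∀ {u k s}, sup u k = some s → G.Adj u s ∧ ρ s < ρ u := by
    intro u k s h
    by_cases hk : k < (S u).card
    · simp only [sup, hk, dif_pos, Option.some_inj] at h
      have := hS u (h ▸ Finset.coe_mem _ : s ∈ S u)
      simpa using this
    · simp [sup, hk] at h
  have hsup_inj : ∀ {u k k' s}, sup u k = some s → sup u k' = some s → k = k' := by
    intro u k k' s h h'
    by_cases hk : k < (S u).card
    · by_cases hk' : k' < (S u).card
      · simp only [sup, hk, hk', dif_pos, Option.some_inj] at h h'
        have := (S u).equivFin.symm.injective (Subtype.ext (h.trans h'.symm))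
        simpa using this
      · simp [sup, hk'] at h'
    · simp [sup, hk] at h
  let w : Fin n → ℕ → Option (Fin n) := fun i j => atPosition ρ (bag i) j
  have hw : ∀ {i j a}, w i j = some a ↔ a ∈ bag i ∧ position ρ (bag i) a = j := fun {i j a} =>
    atPosition_eq_some hinj
  refine ⟨fun i j k => Nat.casesOn k (code (w i j)) (fun k => code ((w i j).bind fun u => sup u k)),
    fun i j k => ?_, fun E hE => ?_⟩
  · cases k with
    | zero => exact code_le _
    | succ k => exact code_le _
  have hE0 : ∀ i, ∀ j : ℕ, j < t → E i j 0 = (code (w i j) : ℕ) := fun i j hj => by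
    simpa using hE i j 0 hj (Nat.zero_le _)
  have hE1 : ∀ i, ∀ j k : ℕ, j < t → k < t →
      E i j ((k : ℤ) + 1) = (code ((w i j).bind fun u => sup u k) : ℕ) := fun i j k hj hk => by
    simpa using hE i j (k + 1) hj hk
  have hEa : ∀ i, ∀ j : ℕ, j < t → ∀ a : Fin n, E i j 0 = (a : ℕ) ↔ w i j = some a :=
    fun i j hj a => by rw [hE0 i j hj, Nat.cast_inj, code_eq]
  have hElt : ∀ i, ∀ j : ℕ, j < t → (E i j 0 < n ↔ ∃ a, w i j = some a) :=
    fun i j hj => by rw [hE0 i j hj, Nat.cast_lt, code_lt]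
  have hEs : ∀ i, ∀ j k : ℕ, j < t → k < t → ∀ u, w i j = some u →
      E i j ((k : ℤ) + 1) = (code (sup u k) : ℕ) := fun i j k hj hk u hu => by
    rw [hE1 i j k hj hk, hu]
    rfl
  -- Were `b` ranked below `a`, it would occupy a slot before that of `a`, as the list is an initial
  -- segment of the bag by rank.
  have hbefore : ∀ i, ∀ a b : Fin n, b ∈ bag i → a ≠ b →
      Before t (fun j => E i j 0) (a : ℕ) (b : ℕ) → ρ a < ρ b := by
    rintro i a b hb hne ⟨j, hj, ha, hj'⟩
    rw [Int.toNat_natCast] at hj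
    obtain ⟨ha, hpos⟩ := hw.1 ((hEa i j hj a).1 ha)
    by_contra hlt
    have hlt' : ρ b < ρ a := lt_of_le_of_ne (not_lt.1 hlt) (hinj.ne hne.symm)
    have hp := position_lt hb hlt'
    exact hj' (position ρ (bag i) b) (by rw [Int.toNat_natCast]; omega) (by omega)
      ((hEa i _ (by omega) b).2 (hw.2 ⟨hb, rfl⟩))
  refine ⟨fun i => ⟨?_, ?_, ?_, ?_⟩, fun i q hq => ⟨?_, ?_⟩, fun i => ?_⟩
  all_goals try simp only [Int.toNat_natCast]
  · intro j hj hlt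
    obtain ⟨a, ha⟩ := (hElt i j hj).1 hlt
    rw [(hEa i j hj a).2 ha, hbag]
    exact (hw.1 ha).1
  · intro j hj hlt j' hj' hjj heq
    obtain ⟨a, ha⟩ := (hElt i j hj).1 hlt
    rw [(hEa i j hj a).2 ha] at heq
    have ha' := (hEa i j' hj' a).1 heq.symm
    have h1 := (hw.1 ha).2
    have h2 := (hw.1 ha').2
    omega
  · intro a ha hmem
    obtain ⟨a, rfl⟩ : ∃ a' : Fin n, (a' : ℕ) = a := ⟨⟨a, ha⟩, rfl⟩
    rw [hbag] at hmem
    -- A vertex at position `t` or beyond is not listed, but then every slot is taken by an earlier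
    -- vertex.
    by_cases hp : position ρ (bag i) a < t
    · exact .inl ⟨_, hp, (hEa i _ hp a).2 (hw.2 ⟨hmem, rfl⟩)⟩
    · refine .inr fun j hj => (hElt i j hj).2 ?_
      obtain ⟨b, hb, hbj⟩ := exists_position_eq hinj (show j < position ρ (bag i) a by omega)
      exact ⟨b, hw.2 ⟨hb, hbj⟩⟩
  · intro j hj hlt k hk hklt
    obtain ⟨u, hu⟩ := (hElt i j hj).1 hlt
    have hk1 := hEs i j k hj hk u hu
    rw [hk1, Nat.cast_lt, code_lt] at hklt
    obtain ⟨s, hs⟩ := hklt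
    rw [hs] at hk1
    rw [hk1, (hEa i j hj u).2 hu]
    obtain ⟨hus, hlt'⟩ := hsup_mem hs
    refine ⟨(hadj _ _).2 hus, ?_, ?_⟩
    · intro k' hk' hkk heq
      rw [hEs i j k' hj hk' u hu, Nat.cast_inj, eq_comm] at heq
      have := hsup_inj hs (code_eq.1 heq)
      omega
    · intro hmem
      have hmem' : s ∈ bag i := (hbag _ _).1 hmem
      have hp := position_lt hmem' hlt'
      have hpu := (hw.1 hu).2
      refine ⟨position ρ (bag i) s, by rw [Int.toNat_natCast]; omega,
        (hEa i _ (by omega) s).2 (hw.2 ⟨hmem', rfl⟩), fun j' hj' hle heq => ?_⟩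
      rw [Int.toNat_natCast] at hj'
      have := (hw.1 ((hEa i j' hj' u).1 heq)).2
      omega
  · intro a ha hsa b hb hsb h1 h2
    obtain ⟨a, rfl⟩ : ∃ a' : Fin n, (a' : ℕ) = a := ⟨⟨a, ha⟩, rfl⟩
    obtain ⟨b, rfl⟩ : ∃ a' : Fin n, (a' : ℕ) = b := ⟨⟨b, hb⟩, rfl⟩
    have hne : a ≠ b := by
      rintro rfl
      obtain ⟨j, hj, hja, hj'⟩ := h1
      exact hj' j hj le_rfl hja
    have hab := hbefore i a b ((hbag _ _).1 (.inr hsb)) hne h1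
    have haq : a ∈ bag q := by
      have h := hsa
      simp only [InSep, hadj, Nat.cast_lt, Fin.val_fin_lt] at h
      simpa [bag] using hq.mem hG h.1 h.2
    exact lt_asymm hab (hbefore q b a haq hne.symm h2)
  · intro a ha hsa j hj hja j' hj' hja' k hk
    obtain ⟨a, rfl⟩ : ∃ a' : Fin n, (a' : ℕ) = a := ⟨⟨a, ha⟩, rfl⟩
    rw [hEs i j k hj hk a ((hEa i j hj a).1 hja), hEs q j' k hj' hk a ((hEa q j' hj' a).1 hja')]
  · have hterm : ∀ j ∈ Finset.range t, (if E i (j : ℕ) 0 = (i : ℕ) then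
        max 0 (τ i - supporters n t (E i) (j : ℕ)) else 0) ≤
        if j = position ρ (bag i) i then (σ i : ℤ) else 0 := by
      intro j hj
      rw [Finset.mem_range] at hj
      have hii : i ∈ bag i := by simp [bag]
      by_cases hji : w i j = some i
      · rw [if_pos ((hEa i j hj i).2 hji), if_pos (hw.1 hji).2.symm]
        refine max_le (Nat.cast_nonneg _) ?_
        have hsc : supporters n t (E i) j = ((S i).card : ℤ) := by
          unfold supporters BSum
          rw [Int.toNat_natCast, Finset.sum_boole, Nat.cast_inj]
          have : (Finset.range t).filter (fun k : ℕ => E i j ((k : ℤ) + 1) < n) =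
              Finset.range (S i).card := by
            ext k
            rw [Finset.mem_filter, Finset.mem_range, Finset.mem_range]
            constructor
            · rintro ⟨hk, h⟩
              rw [hEs i j k hj hk i hji, Nat.cast_lt, code_lt] at h
              by_contra hk'
              simp [sup, hk'] at h
            · intro hk
              have hkt : k < t := hk.trans_le ((hcard i).trans_le (min_le_left _ _))
              refine ⟨hkt, ?_⟩
              rw [hEs i j k hj hkt i hji, Nat.cast_lt, code_lt]
              simp [sup, hk]
          rw [this, Finset.card_range]
        -- With `m` earlier neighbors the requirement is `τ i - min t m ≤ σ i`. It follows from `τ i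
        -- - σ i ≤ m` and `τ i ≤ t`.
        rw [hsc, hcard]
        have h1 := hρ i
        have h2 := hτ i
        have h3 : {v | G.Adj i v ∧ ρ v < ρ i}.ncard =
            (Finset.univ.filter fun v => G.Adj i v ∧ ρ v < ρ i).card := by
          rw [← Set.ncard_coe_finset]
          simp
        rw [h3] at h1
        omega
      · rw [if_neg fun h => hji ((hEa i j hj i).1 h)]
        split_ifs <;> simp
    unfold incentive BSum
    rw [Int.toNat_natCast]
    refine (Finset.sum_le_sum hterm).trans ?_
    rw [Finset.sum_ite_eq']
    split_ifs <;> simp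

end Completeness

/-! ## Relabeling -/

theorem isHullClosed_comap_iff {V W : Type*} (π : V ≃ W) (G : SimpleGraph W) (θ : W → ℤ)
    (H : Set W) : IsHullClosed (G.comap π) (fun u => θ (π u)) (π ⁻¹' H) ↔ IsHullClosed G θ H := by
  have hcard : ∀ u, (π ⁻¹' H ∩ (G.comap π).neighborSet u).ncard = (H ∩ G.neighborSet (π u)).ncard := by
    intro u
    rw [← Set.ncard_image_of_injective _ π.injective]
    congr 1
    ext w
    constructor
    · rintro ⟨v, ⟨hv, hadj⟩, rfl⟩
      exact ⟨hv, hadj⟩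
    · rintro ⟨hw, hadj⟩
      exact ⟨π.symm w, ⟨by simpa using hw, by simpa using hadj⟩, by simp⟩
  unfold IsHullClosed
  simp only [hcard, Set.mem_preimage]
  exact π.forall_congr_left.trans (by simp)

theorem isPartialIncentive_comap_iff {V W : Type*} (π : V ≃ W) (G : SimpleGraph W) (τ : W → ℤ)
    (σ : W → ℕ) : IsPartialIncentive (G.comap π) (fun u => τ (π u)) (fun u => σ (π u)) ↔
      IsPartialIncentive G τ σ := by
  rw [isPartialIncentive_iff, isPartialIncentive_iff]
  constructor
  · intro h H hH w
    have := h _ ((isHullClosed_comap_iff π G (fun u => τ u - (σ u : ℤ)) H).2 hH) (π.symm w)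
    simpa using this
  · intro h H hH u
    have hH' : IsHullClosed G (fun u => τ u - (σ u : ℤ)) (π.symm ⁻¹' H) := by
      rw [← isHullClosed_comap_iff π]
      simpa [← Set.preimage_comp] using hH
    simpa using h _ hH' (π u)

theorem IsOptimalPartialIncentive.of_comap {V W : Type*} [Fintype V] [Fintype W] (π : V ≃ W)
    {G : SimpleGraph W} {τ : W → ℤ} {σ : W → ℕ}
    (h : IsOptimalPartialIncentive (G.comap π) (fun u => τ (π u)) (fun u => σ (π u))) :
    IsOptimalPartialIncentive G τ σ := by
  refine ⟨(isPartialIncentive_comap_iff π G τ σ).1 h.1, fun σ' hσ' => ?_⟩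
  have := h.2 _ ((isPartialIncentive_comap_iff π G τ σ').2 hσ')
  rwa [Equiv.sum_comp π, Equiv.sum_comp π] at this

/-- Paying the whole threshold leaves nothing to be supplied by neighbors. The weight of this
incentive is what the penalty has to exceed. -/
theorem isPartialIncentive_toNat {V : Type*} (G : SimpleGraph V) (τ : V → ℤ) :
    IsPartialIncentive G τ (fun u => (τ u).toNat) := by
  rw [isPartialIncentive_iff]
  exact fun H hH u => hH u (by
    change τ u - ((τ u).toNat : ℤ) ≤ _
    omega)

/-- Every nonempty set of vertices of an interval graph has a simplicial vertex. -/
theorem IsIntervalGraph.exists_simplicial {V : Type*} {G : SimpleGraph V} (h : IsIntervalGraph G)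
    {R : Finset V} (hR : R.Nonempty) :
    ∃ v ∈ R, ∀ a ∈ R, G.Adj v a → ∀ b ∈ R, G.Adj v b → a ≠ b → G.Adj a b := by
  obtain ⟨l, r, -, hadj⟩ := h
  -- If `v` has the smallest right endpoint, then that endpoint lies in the interval of every
  -- neighbor of `v` in `R`, so these neighbors intersect pairwise.
  obtain ⟨v, hv, hmin⟩ := Finset.exists_min_image R r hR
  refine ⟨v, hv, fun a ha hva b hb hvb hab => ?_⟩
  have key : ∀ c ∈ R, G.Adj v c → r v ∈ Set.Icc (l c) (r c) := by
    intro c hc hvc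
    obtain ⟨x, hx, hx'⟩ := (hadj v c hvc.ne).1 hvc
    exact ⟨hx'.1.trans hx.2, hmin c hc⟩
  exact (hadj a b hab).2 ⟨r v, key a ha hva, key b hb hvb⟩

/-! ## Minimization over a forest -/

/-- Optimality of dynamic programming on a forest, in which the parent of `i` is `par i`, with `n` as
the parent of the roots: `D i x` is the least cost below `i` if `i` has the label `x`,
and `Z i x` is the best label of `i` if its parent has the label `x`. -/
theorem forest_dp_optimal {n M : ℕ} {par : ℕ → ℕ} {c : ℕ → ℕ → ℤ} {e : ℕ → ℕ → ℕ → ℤ}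
    {D : ℕ → ℕ → ℤ} {Z : ℕ → ℕ → ℕ} {X : ℕ → ℕ}
    (hpar : ∀ i < n, par i ≤ n) (hroot : ∀ i < n, par i = n → ∀ y x, e i y x = 0)
    (hD : ∀ i < n, ∀ x < M, D i x = c i x +
      ∑ j ∈ Finset.range n, if par j = i then D j (Z j x) + e j (Z j x) x else 0)
    (hZ : ∀ i < n, ∀ x, ∀ y < M, D i (Z i x) + e i (Z i x) x ≤ D i y + e i y x)
    (hXM : ∀ i < n, X i < M) (hX : ∀ i < n, X i = Z i (X (par i)))
    {Y : ℕ → ℕ} (hY : ∀ i < n, Y i < M) :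
    ∑ i ∈ Finset.range n, (c i (X i) + e i (X i) (X (par i))) ≤
      ∑ i ∈ Finset.range n, (c i (Y i) + e i (Y i) (Y (par i))) := by
  have hswap : ∀ (f : ℕ → ℕ → ℤ) (Y : ℕ → ℕ), ∑ i ∈ Finset.range n, ∑ j ∈ Finset.range n,
      (if par j = i then f j (Y i) else 0) =
      ∑ j ∈ Finset.range n, if par j = n then 0 else f j (Y (par j)) := by
    intro f Y
    rw [Finset.sum_comm]
    refine Finset.sum_congr rfl fun j hj => ?_
    rw [Finset.sum_ite_eq]
    have := hpar j (Finset.mem_range.1 hj)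
    split_ifs with h1 h2 h2
    · rw [Finset.mem_range] at h1
      omega
    · rfl
    · rfl
    · rw [Finset.mem_range] at h1
      omega
  -- Each `D i (Y i)` is subtracted at `i` and added back on the edge to the parent of `i`, or at
  -- the root. Regrouping the edges by parent yields one bracket per vertex.
  have hlow : ∀ Y : ℕ → ℕ, ∑ i ∈ Finset.range n, (c i (Y i) + e i (Y i) (Y (par i))) =
      ∑ i ∈ Finset.range n, (c i (Y i) - D i (Y i)) +
      (∑ j ∈ Finset.range n, if par j = n then 0 else D j (Y j) + e j (Y j) (Y (par j))) +
      ∑ j ∈ Finset.range n, if par j = n then D j (Y j) + e j (Y j) (Y (par j)) else 0 := by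
    intro Y
    rw [← Finset.sum_add_distrib, ← Finset.sum_add_distrib]
    refine Finset.sum_congr rfl fun j _ => ?_
    split_ifs <;> ring
  rw [hlow X, hlow Y, ← hswap (fun j y => D j (X j) + e j (X j) y),
    ← hswap (fun j y => D j (Y j) + e j (Y j) y)]
  -- The recursion makes every bracket vanish for the chosen labels, while for arbitrary labels
  -- minimality of `Z` makes it nonnegative.
  have hXeq : ∑ i ∈ Finset.range n, (c i (X i) - D i (X i) + ∑ j ∈ Finset.range n,
      if par j = i then D j (X j) + e j (X j) (X i) else 0) = 0 := by
    refine Finset.sum_eq_zero fun i hi => ?_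
    rw [Finset.mem_range] at hi
    rw [hD i hi _ (hXM i hi), sub_add_eq_sub_sub, sub_self, zero_sub, neg_add_eq_zero]
    refine Finset.sum_congr rfl fun j hj => ?_
    split_ifs with h
    · rw [hX j (Finset.mem_range.1 hj), h]
    · rfl
  have hYle : 0 ≤ ∑ i ∈ Finset.range n, (c i (Y i) - D i (Y i) + ∑ j ∈ Finset.range n,
      if par j = i then D j (Y j) + e j (Y j) (Y i) else 0) := by
    refine Finset.sum_nonneg fun i hi => ?_
    rw [Finset.mem_range] at hi
    rw [hD i hi _ (hY i hi), sub_add_eq_sub_sub, sub_self, zero_sub, neg_add_eq_sub, sub_nonneg]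
    refine Finset.sum_le_sum fun j hj => ?_
    rw [Finset.mem_range] at hj
    split_ifs with h
    · exact hZ j hj _ _ (hY j hj)
    · exact le_rfl
  have hr : (∑ j ∈ Finset.range n, if par j = n then D j (X j) + e j (X j) (X (par j)) else 0) ≤
      ∑ j ∈ Finset.range n, if par j = n then D j (Y j) + e j (Y j) (Y (par j)) else 0 := by
    refine Finset.sum_le_sum fun j hj => ?_
    rw [Finset.mem_range] at hj
    split_ifs with h
    · have := hZ j hj (X (par j)) _ (hY j hj)
      rw [hX j hj]
      -- The labels at the fictitious parent `n` are uncontrolled, but the edge cost there is zero.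
      rwa [hroot j hj h (Y j) (Y (par j)), ← hroot j hj h (Y j) (X (par j))]
    · exact le_rfl
  rw [Finset.sum_add_distrib] at hXeq hYle
  linarith

/-! ## The functions computed by the algorithm

The entries of array `9` are `n`, `t`, `n + 1`, `K = t * (t + 1)`, `K + 1`, `M = (n + 1) ^ K`,
`(n + 1) * M` and `t + 1`, in this order. Array `5` holds the powers of `n + 1`, array `6` the elimination
ordering, array `7` the table of the dynamic program, and array `8` the chosen schedules, in
reverse order. -/

/-- The product of `x` and `y`. -/
def mulF (A : Arr) (x y : ℤ) : ℤ := BSum (A 9 6).toNat fun z => if z < y then x else 0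

/-- The quotient of `x` and `y`. -/
def divF (A : Arr) (x y : ℤ) : ℤ := BSum (A 9 6).toNat fun z => if mulF A (z + 1) y ≤ x then 1 else 0

/-- The remainder of `x` modulo `y`. -/
def modF (A : Arr) (x y : ℤ) : ℤ := x - mulF A (divF A x y) y

/-- The entry `(j, k)` of the local schedule with number `x`. -/
def ent (A : Arr) (x j k : ℤ) : ℤ :=
  modF A (divF A x (A 5 ((BSum (A 9 7).toNat fun _ => j) + k))) (A 9 2)

/-- Adjacency in the input graph. -/
def adjF (A : Arr) (u v : ℤ) : Prop := 0 < A 0 ((BSum (A 9 0).toNat fun _ => u) + v)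

/-- Adjacency of the `i`-th and the `j`-th vertex of the elimination ordering. -/
def adjR (A : Arr) (i j : ℤ) : Prop := adjF A (A 6 i) (A 6 j)

/-- `v` is among the first `z` vertices of the elimination ordering. -/
def usedF (A : Arr) (z v : ℤ) : Prop := BEx (A 9 0).toNat fun y => y < z ∧ A 6 y = v

/-- The `z`-th vertex of the elimination ordering. -/
noncomputable def peoF (A : Arr) (z : ℤ) : ℤ := findFirst (A 9 0).toNat fun v => ¬ usedF A z v ∧
  BAll (A 9 0).toNat fun a => ¬ usedF A z a → adjF A v a →
    BAll (A 9 0).toNat fun b => ¬ usedF A z b → adjF A v b → a ≠ b → adjF A a b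

/-- The first later neighbor of `i`. -/
noncomputable def parF (A : Arr) (i : ℤ) : ℤ :=
  findFirst (A 9 0).toNat fun a => InSep (adjR A) i a

/-- The penalty for violated constraints. -/
def penalty (A : Arr) : ℤ := BSum (A 9 2).toNat fun _ => A 9 7

/-- The incentive of vertex `i` under the schedule `x`. -/
def incF (A : Arr) (i x : ℤ) : ℤ :=
  incentive (A 9 0) (A 9 1) (A 1 (A 6 i)) i fun j k => ent A x j k

open Classical in
/-- The cost of the schedule `x` for `i`. -/
noncomputable def costF (A : Arr) (i x : ℤ) : ℤ := incF A i x +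
  if Valid (A 9 0) (A 9 1) (fun a b => adjR A a b) i (fun j k => ent A x j k) then 0 else penalty A

open Classical in
/-- The cost of the schedule `x` for `i` together with the schedule `y` for its parent. -/
noncomputable def edgeF (A : Arr) (i x y : ℤ) : ℤ :=
  if Compat (A 9 0) (A 9 1) (fun a b => adjR A a b) i (fun j k => ent A x j k)
    (fun j k => ent A y j k) then 0 else penalty A

/-- The least cost below `j`, and on the edge above, if `j` has the schedule `x` and its parent
has the schedule `y`. -/
noncomputable def branchF (A : Arr) (j x y : ℤ) : ℤ :=
  A 7 (mulF A j (A 9 5) + x) + edgeF A j x y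

/-- The best schedule for `j` if its parent has the schedule `y`. -/
noncomputable def bestF (A : Arr) (j y : ℤ) : ℤ :=
  argmin (A 9 5).toNat fun x => branchF A j x y

/-- The least cost below `i` if `i` has the schedule `x`. -/
noncomputable def lowF (A : Arr) (i x : ℤ) : ℤ := costF A i x +
  BSum (A 9 0).toNat fun j => if parF A j = i then branchF A j (bestF A j x) x else 0

/-- The entries of the table of the dynamic program. -/
noncomputable def dpF (A : Arr) (z : ℤ) : ℤ := lowF A (divF A z (A 9 5)) (modF A z (A 9 5))

/-- The chosen schedule for vertex `n - 1 - z`. -/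
noncomputable def chooseF (A : Arr) (z : ℤ) : ℤ :=
  bestF A (A 9 0 - 1 - z) (A 8 (A 9 0 - 1 - parF A (A 9 0 - 1 - z)))

/-- The output for vertex `v`. -/
noncomputable def outF (A : Arr) (v : ℤ) : ℤ :=
  BSum (A 9 0).toNat fun i => if A 6 i = v then incF A i (A 8 (A 9 0 - 1 - i)) else 0

theorem PComp.mulF {f g : Arr → (ℕ → ℤ) → ℤ} (hf : PComp f) (hg : PComp g) :
    PComp (fun A v => mulF A (f A v) (g A v)) := by
  refine PComp.comp₂ (F := PartialIncentives.mulF) ?_ hf hg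
  unfold PartialIncentives.mulF
  repeat' first
    | with_reducible apply PComp.sum | with_reducible apply PComp.ite | with_reducible apply PDec.lt
    | with_reducible apply PComp.var | with_reducible apply PComp.const

theorem PComp.divF {f g : Arr → (ℕ → ℤ) → ℤ} (hf : PComp f) (hg : PComp g) :
    PComp (fun A v => divF A (f A v) (g A v)) := by
  refine PComp.comp₂ (F := PartialIncentives.divF) ?_ hf hg
  unfold PartialIncentives.divF
  repeat' first
    | with_reducible apply PComp.sum | with_reducible apply PComp.ite | with_reducible apply PDec.le
    | with_reducible apply PComp.mulF | with_reducible apply PComp.add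
    | with_reducible apply PComp.var | with_reducible apply PComp.const

theorem PComp.modF {f g : Arr → (ℕ → ℤ) → ℤ} (hf : PComp f) (hg : PComp g) :
    PComp (fun A v => modF A (f A v) (g A v)) :=
  hf.sub ((hf.divF hg).mulF hg)

theorem PComp.bound (j : ℤ) : PComp (fun A _ => A 9 j) := (PComp.const j).get 9

theorem PComp.mulBound (j : ℤ) {f : Arr → (ℕ → ℤ) → ℤ} (hf : PComp f) :
    PComp (fun A v => BSum (A 9 j).toNat fun _ => f A v) :=
  PComp.sum j (f := fun A v _ => f A v) (hf.rename Nat.succ)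

theorem PComp.ent {f g h : Arr → (ℕ → ℤ) → ℤ} (hf : PComp f) (hg : PComp g) (hh : PComp h) :
    PComp (fun A v => ent A (f A v) (g A v) (h A v)) :=
  (hf.divF (((hg.mulBound 7).add hh).get 5)).modF (.bound 2)

theorem PDec.adjF {f g : Arr → (ℕ → ℤ) → ℤ} (hf : PComp f) (hg : PComp g) :
    PDec (fun A v => adjF A (f A v) (g A v)) :=
  PDec.pos (((hf.mulBound 0).add hg).get 0)

theorem PDec.adjR {f g : Arr → (ℕ → ℤ) → ℤ} (hf : PComp f) (hg : PComp g) :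
    PDec (fun A v => adjR A (f A v) (g A v)) := PDec.adjF (hf.get 6) (hg.get 6)

theorem PDec.usedF {f g : Arr → (ℕ → ℤ) → ℤ} (hf : PComp f) (hg : PComp g) :
    PDec (fun A v => usedF A (f A v) (g A v)) := by
  refine PDec.comp₂ (P := PartialIncentives.usedF) ?_ hf hg
  unfold PartialIncentives.usedF
  repeat' first
    | with_reducible apply PDec.ex | with_reducible apply PDec.and | with_reducible apply PDec.lt
    | with_reducible apply PDec.eq | with_reducible apply PComp.get | with_reducible apply PComp.var

theorem PComp.peoF {f : Arr → (ℕ → ℤ) → ℤ} (hf : PComp f) : PComp (fun A v => peoF A (f A v)) := by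
  refine PComp.comp₁ (F := PartialIncentives.peoF) ?_ hf
  unfold PartialIncentives.peoF
  repeat' first
    | with_reducible apply PComp.findFirst | with_reducible apply PDec.and
    | with_reducible apply PDec.usedF | with_reducible apply PDec.adjF | with_reducible apply PDec.ne
    | with_reducible apply PDec.not | with_reducible apply PDec.all | with_reducible apply PDec.imp
    | with_reducible apply PComp.var

theorem PComp.parF {f : Arr → (ℕ → ℤ) → ℤ} (hf : PComp f) : PComp (fun A v => parF A (f A v)) := by
  refine PComp.comp₁ (F := PartialIncentives.parF) ?_ hf
  unfold PartialIncentives.parF InSep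
  repeat' first
    | with_reducible apply PComp.findFirst | with_reducible apply PDec.and
    | with_reducible apply PDec.adjR | with_reducible apply PDec.lt | with_reducible apply PComp.var

theorem PComp.penalty : PComp (fun A _ => penalty A) := by
  unfold PartialIncentives.penalty
  exact PComp.sum 2 (PComp.bound 7)

theorem PComp.incF {f g : Arr → (ℕ → ℤ) → ℤ} (hf : PComp f) (hg : PComp g) :
    PComp (fun A v => incF A (f A v) (g A v)) := by
  refine PComp.comp₂ (F := PartialIncentives.incF) ?_ hf hg
  unfold PartialIncentives.incF incentive supporters
  repeat' first
    | with_reducible apply PComp.sum | with_reducible apply PComp.ite | with_reducible apply PDec.eq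
    | with_reducible apply PDec.lt | with_reducible apply PComp.max | with_reducible apply PComp.sub
    | with_reducible apply PComp.add | with_reducible apply PComp.ent | with_reducible apply PComp.get
    | with_reducible apply PComp.var | with_reducible apply PComp.const

theorem PComp.costF {f g : Arr → (ℕ → ℤ) → ℤ} (hf : PComp f) (hg : PComp g) :
    PComp (fun A v => costF A (f A v) (g A v)) := by
  refine PComp.comp₂ (F := PartialIncentives.costF) ?_ hf hg
  unfold PartialIncentives.costF Valid InBag InSep Before
  repeat' first
    | with_reducible apply PComp.add | with_reducible apply PComp.incF
    | with_reducible apply PComp.ite | with_reducible apply PComp.penalty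
    | with_reducible apply PComp.ent | with_reducible apply PComp.get | with_reducible apply PComp.var
    | with_reducible apply PComp.const | with_reducible apply PDec.and | with_reducible apply PDec.or
    | with_reducible apply PDec.all | with_reducible apply PDec.ex | with_reducible apply PDec.ne
    | with_reducible apply PDec.eq | with_reducible apply PDec.lt | with_reducible apply PDec.le
    | with_reducible apply PDec.adjR | with_reducible apply PDec.imp

theorem PComp.edgeF {f g h : Arr → (ℕ → ℤ) → ℤ} (hf : PComp f) (hg : PComp g) (hh : PComp h) :
    PComp (fun A v => edgeF A (f A v) (g A v) (h A v)) := by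
  refine PComp.comp₃ (F := PartialIncentives.edgeF) ?_ hf hg hh
  unfold PartialIncentives.edgeF Compat InSep Before
  repeat' first
    | with_reducible apply PComp.add | with_reducible apply PComp.ite
    | with_reducible apply PComp.penalty
    | with_reducible apply PComp.ent | with_reducible apply PComp.get | with_reducible apply PComp.var
    | with_reducible apply PComp.const | with_reducible apply PDec.and | with_reducible apply PDec.not
    | with_reducible apply PDec.all | with_reducible apply PDec.ex | with_reducible apply PDec.ne
    | with_reducible apply PDec.eq | with_reducible apply PDec.lt | with_reducible apply PDec.le
    | with_reducible apply PDec.adjR | with_reducible apply PDec.imp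

theorem PComp.branchF {f g h : Arr → (ℕ → ℤ) → ℤ} (hf : PComp f) (hg : PComp g) (hh : PComp h) :
    PComp (fun A v => branchF A (f A v) (g A v) (h A v)) :=
  (((hf.mulF (.bound 5)).add hg).get 7).add (hf.edgeF hg hh)

theorem PComp.bestF {f g : Arr → (ℕ → ℤ) → ℤ} (hf : PComp f) (hg : PComp g) :
    PComp (fun A v => bestF A (f A v) (g A v)) := by
  refine PComp.comp₂ (F := PartialIncentives.bestF) ?_ hf hg
  unfold PartialIncentives.bestF
  exact PComp.argmin 5 (f := fun A v x => PartialIncentives.branchF A (v 0) x (v 1))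
    (.branchF (.var 1) (.var 0) (.var 2))

theorem PComp.lowF {f g : Arr → (ℕ → ℤ) → ℤ} (hf : PComp f) (hg : PComp g) :
    PComp (fun A v => lowF A (f A v) (g A v)) := by
  refine PComp.comp₂ (F := PartialIncentives.lowF) ?_ hf hg
  unfold PartialIncentives.lowF
  repeat' first
    | with_reducible apply PComp.add | with_reducible apply PComp.costF
    | with_reducible apply PComp.sum | with_reducible apply PComp.ite | with_reducible apply PDec.eq
    | with_reducible apply PComp.parF | with_reducible apply PComp.branchF
    | with_reducible apply PComp.bestF | with_reducible apply PComp.var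
    | with_reducible apply PComp.const

theorem PComp.dpF : PComp (fun A v => dpF A (v 0)) :=
  .lowF (.divF (.var 0) (.bound 5)) (.modF (.var 0) (.bound 5))

theorem PComp.chooseF : PComp (fun A v => chooseF A (v 0)) :=
  have h : PComp fun A v => A 9 0 - 1 - v 0 := ((PComp.bound 0).sub (.const 1)).sub (.var 0)
  .bestF h ((((PComp.bound 0).sub (.const 1)).sub h.parF).get 8)

theorem PComp.outF : PComp (fun A v => outF A (v 0)) := by
  unfold PartialIncentives.outF
  repeat' first
    | with_reducible apply PComp.sum | with_reducible apply PComp.ite | with_reducible apply PDec.eq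
    | with_reducible apply PComp.incF | with_reducible apply PComp.get
    | with_reducible apply PComp.sub | with_reducible apply PComp.var | with_reducible apply PComp.const

/-! ## Correctness of the algorithm -/

/-- The loop bounds and the powers of `n + 1` are in place. -/
structure Sizes (n t : ℕ) (A : Arr) : Prop where
  b0 : A 9 0 = n
  b1 : A 9 1 = t
  b2 : A 9 2 = (n + 1 : ℕ)
  b5 : A 9 5 = ((n + 1) ^ (t * (t + 1)) : ℕ)
  b6 : A 9 6 = ((n + 1) * (n + 1) ^ (t * (t + 1)) : ℕ)
  b7 : A 9 7 = (t + 1 : ℕ)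
  pow : ∀ z : ℕ, z ≤ t * (t + 1) → A 5 z = ((n + 1) ^ z : ℕ)

theorem BSum_const (N : ℕ) (x : ℤ) : (BSum N fun _ => x) = x * N := by
  simp [BSum, mul_comm]

theorem card_filter_range_lt {y N : ℕ} (h : y ≤ N) :
    ((Finset.range N).filter fun z => z < y).card = y := by
  have : (Finset.range N).filter (fun z => z < y) = Finset.range y := by
    ext z
    simp only [Finset.mem_filter, Finset.mem_range]
    omega
  rw [this, Finset.card_range]

/-! ### Arithmetic and digits -/

section Evaluation

variable {n t : ℕ} {A : Arr}

/-- The summand `x` is added once for each `z < y`; this is correct only while `y` does not exceed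
the loop bound. -/
theorem Sizes.mulF_eq (h : Sizes n t A) (x : ℤ) {y : ℕ}
    (hy : y ≤ (n + 1) * (n + 1) ^ (t * (t + 1))) : mulF A x y = x * y := by
  unfold mulF BSum
  rw [h.b6, Int.toNat_natCast]
  simp only [Nat.cast_lt]
  rw [← Finset.sum_filter, Finset.sum_const, card_filter_range_lt hy, nsmul_eq_mul, mul_comm]

/-- The quotient is the number of `z` with `(z + 1) * y ≤ x`. -/
theorem Sizes.divF_eq (h : Sizes n t A) {x y : ℕ} (hx : x ≤ (n + 1) * (n + 1) ^ (t * (t + 1)))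
    (hy0 : 0 < y) (hy : y ≤ (n + 1) * (n + 1) ^ (t * (t + 1))) : divF A x y = (x / y : ℕ) := by
  unfold divF BSum
  rw [h.b6, Int.toNat_natCast]
  have : ∀ z : ℕ, mulF A ((z : ℤ) + 1) y ≤ (x : ℤ) ↔ z < x / y := by
    intro z
    rw [h.mulF_eq _ hy, ← Nat.succ_le_iff, Nat.le_div_iff_mul_le hy0]
    exact_mod_cast Iff.rfl
  simp only [this]
  rw [Finset.sum_boole, card_filter_range_lt ((Nat.div_le_self x y).trans hx)]

theorem Sizes.modF_eq (h : Sizes n t A) {x y : ℕ} (hx : x ≤ (n + 1) * (n + 1) ^ (t * (t + 1)))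
    (hy0 : 0 < y) (hy : y ≤ (n + 1) * (n + 1) ^ (t * (t + 1))) : modF A x y = (x % y : ℕ) := by
  unfold modF
  rw [h.divF_eq hx hy0 hy, h.mulF_eq _ hy]
  have : ((x / y : ℕ) : ℤ) * y + (x % y : ℕ) = x := by exact_mod_cast Nat.div_add_mod' x y
  linarith

theorem slot_lt {t j k : ℕ} (hj : j < t) (hk : k ≤ t) : j * (t + 1) + k < t * (t + 1) := by
  have : (j + 1) * (t + 1) ≤ t * (t + 1) := Nat.mul_le_mul_right _ hj
  rw [add_mul] at this
  omega

/-- A schedule is a numeral in base `n + 1`, and its entries are the digits, stored row by row with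
`t + 1` digits per slot. -/
theorem Sizes.ent_eq (h : Sizes n t A) {x j k : ℕ} (hx : x < (n + 1) ^ (t * (t + 1))) (hj : j < t)
    (hk : k ≤ t) : ent A x j k = (x / (n + 1) ^ (j * (t + 1) + k) % (n + 1) : ℕ) := by
  have hM : 0 < (n + 1) ^ (t * (t + 1)) := by positivity
  have hML : (n + 1) ^ (t * (t + 1)) ≤ (n + 1) * (n + 1) ^ (t * (t + 1)) :=
    Nat.le_mul_of_pos_left _ (by omega)
  have hslot := slot_lt hj hk
  have hidx : (BSum (A 9 7).toNat fun _ => (j : ℤ)) + k = ((j * (t + 1) + k : ℕ) : ℤ) := by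
    rw [BSum_const, h.b7, Int.toNat_natCast]
    push_cast
    ring
  unfold ent
  rw [hidx, h.pow _ hslot.le, h.b2, h.divF_eq (hx.le.trans hML) (by positivity)
    ((Nat.pow_le_pow_right (by omega) hslot.le).trans hML), h.modF_eq
    ((Nat.div_le_self _ _).trans (hx.le.trans hML)) (by omega) (Nat.le_mul_of_pos_right _ hM)]

/-- Every local schedule has a number. -/
theorem Sizes.exists_code (h : Sizes n t A) (g : ℕ → ℕ → ℕ) (hg : ∀ j k, g j k ≤ n) :
    ∃ x : ℕ, x < (n + 1) ^ (t * (t + 1)) ∧ ∀ j k : ℕ, j < t → k ≤ t → ent A x j k = g j k := by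
  let f : Fin (t * (t + 1)) → Fin (n + 1) := fun q =>
    ⟨g (q / (t + 1)) (q % (t + 1)), Nat.lt_succ_of_le (hg _ _)⟩
  refine ⟨finFunctionFinEquiv f, (finFunctionFinEquiv f).2, fun j k hj hk => ?_⟩
  rw [h.ent_eq (finFunctionFinEquiv f).2 hj hk]
  -- The inverse of `finFunctionFinEquiv` extracts digits by exactly this formula.
  have hf : ∀ q : Fin (t * (t + 1)), (finFunctionFinEquiv f : ℕ) / (n + 1) ^ (q : ℕ) % (n + 1) = f q := by
    intro q
    conv_rhs => rw [← finFunctionFinEquiv.symm_apply_apply f]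
    rfl
  have := hf ⟨j * (t + 1) + k, slot_lt hj hk⟩
  simp only at this
  rw [this]
  have h1 : (j * (t + 1) + k) / (t + 1) = j := by
    rw [add_comm, Nat.add_mul_div_right _ _ (by omega), Nat.div_eq_of_lt (by omega), zero_add]
  have h2 : (j * (t + 1) + k) % (t + 1) = k := by
    rw [add_comm, Nat.add_mul_mod_self_right, Nat.mod_eq_of_lt (by omega)]
  simp only [f, h1, h2]

theorem Sizes.penalty_eq (h : Sizes n t A) : penalty A = ((n + 1) * (t + 1) : ℕ) := by
  unfold penalty
  rw [BSum_const, h.b2, h.b7, Int.toNat_natCast]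
  push_cast
  ring

end Evaluation

theorem argmin_congr {N : ℕ} {f g : ℤ → ℤ} (h : ∀ y : ℕ, y < N → f y = g y) :
    argmin N f = argmin N g := by
  by_cases hN : 0 < N
  · have hf : ∃ z : ℕ, z < N ∧ BAll N (fun y => f z ≤ f y) := by
      obtain ⟨z, hz, _, hm⟩ := argmin_spec hN f
      exact ⟨z, hz, hm⟩
    obtain ⟨z, hz, he, hP, hmin⟩ := findFirst_spec (P := fun z => BAll N (fun y => f z ≤ f y)) hf
    unfold argmin
    rw [he, eq_comm]
    refine findFirst_eq hz (fun y hy => ?_) (fun y hy hP' => hmin y hy fun y' hy' => ?_)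
    · change g z ≤ g y
      rw [← h y hy, ← h z hz]
      exact hP y hy
    · change f y ≤ f y'
      rw [h y (hy.trans hz), h y' hy']
      exact hP' y' hy'
  · obtain rfl : N = 0 := by omega
    simp [argmin, findFirst, BSum]

/-- The input and the relabeled graph are represented by the arrays. -/
structure Represents {n : ℕ} (G : SimpleGraph (Fin n)) (τ : Fin n → ℤ) (A : Arr) : Prop where
  adj : ∀ u v : Fin n, 0 < A 0 ((u : ℕ) * (n : ℤ) + (v : ℕ)) ↔ G.Adj u v
  thr : ∀ u : Fin n, A 1 (u : ℕ) = τ u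
  size : A 9 0 = n

theorem Represents.adjF_iff {n : ℕ} {G : SimpleGraph (Fin n)} {τ : Fin n → ℤ} {A : Arr}
    (h : Represents G τ A) (u v : Fin n) : adjF A (u : ℕ) (v : ℕ) ↔ G.Adj u v := by
  unfold adjF
  rw [BSum_const, h.size, Int.toNat_natCast]
  exact h.adj u v

/-- `A` and `A'` agree in the arrays that hold the constraint problem. -/
def SameProblem (A A' : Arr) : Prop :=
  A' 0 = A 0 ∧ A' 1 = A 1 ∧ A' 5 = A 5 ∧ A' 6 = A 6 ∧ A' 9 = A 9

theorem SameProblem.adjR {A A' : Arr} (h : SameProblem A A') : adjR A' = adjR A := by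
  obtain ⟨h0, h1, h5, h6, h9⟩ := h
  funext i j
  simp only [PartialIncentives.adjR, adjF, h0, h6, h9]

theorem SameProblem.mulF {A A' : Arr} (h : SameProblem A A') : mulF A' = mulF A := by
  unfold PartialIncentives.mulF
  rw [h.2.2.2.2]

theorem SameProblem.divF {A A' : Arr} (h : SameProblem A A') : divF A' = divF A := by
  unfold PartialIncentives.divF
  rw [h.mulF, h.2.2.2.2]

theorem SameProblem.modF {A A' : Arr} (h : SameProblem A A') : modF A' = modF A := by
  unfold PartialIncentives.modF
  rw [h.mulF, h.divF]

theorem SameProblem.ent {A A' : Arr} (h : SameProblem A A') : ent A' = ent A := by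
  unfold PartialIncentives.ent
  rw [h.modF, h.divF, h.2.2.1, h.2.2.2.2]

theorem SameProblem.incF {A A' : Arr} (h : SameProblem A A') : incF A' = incF A := by
  unfold PartialIncentives.incF
  rw [h.ent, h.2.1, h.2.2.2.1, h.2.2.2.2]

theorem SameProblem.penalty {A A' : Arr} (h : SameProblem A A') : penalty A' = penalty A := by
  unfold PartialIncentives.penalty
  rw [h.2.2.2.2]

theorem SameProblem.costF {A A' : Arr} (h : SameProblem A A') : costF A' = costF A := by
  unfold PartialIncentives.costF
  rw [h.incF, h.adjR, h.ent, h.penalty, h.2.2.2.2]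

theorem SameProblem.edgeF {A A' : Arr} (h : SameProblem A A') : edgeF A' = edgeF A := by
  unfold PartialIncentives.edgeF
  rw [h.adjR, h.ent, h.penalty, h.2.2.2.2]

theorem SameProblem.parF {A A' : Arr} (h : SameProblem A A') : parF A' = parF A := by
  unfold PartialIncentives.parF
  rw [h.adjR, h.2.2.2.2]

/-- Array `6` holds the perfect elimination ordering `π`. -/
def Ordered {n : ℕ} (G : SimpleGraph (Fin n)) (π : Fin n ≃ Fin n) (A : Arr) : Prop :=
  (∀ i : Fin n, A 6 (i : ℕ) = (π i : ℕ)) ∧ IsPEO (G.comap π)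

/-- In each round the unused vertices are nonempty and hence contain a simplicial vertex, so the
greedy search succeeds. The intervals only guarantee existence; the program never needs them. -/
theorem exists_ordered {n : ℕ} {G : SimpleGraph (Fin n)} {τ : Fin n → ℤ} {A : Arr}
    (hG : IsIntervalGraph G) (h : Represents G τ A) :
    ∃ π, Ordered G π (tabulate 6 0 peoF A) := by
  classical
  set A' := tabulate 6 0 peoF A with hA'
  have key : ∀ i : Fin n, ∃ v : Fin n, A' 6 (i : ℕ) = (v : ℕ) ∧
      (∀ y : ℕ, y < i → A' 6 y ≠ (v : ℕ)) ∧
      ∀ a b : Fin n, (∀ y : ℕ, y < i → A' 6 y ≠ (a : ℕ)) → (∀ y : ℕ, y < i → A' 6 y ≠ (b : ℕ)) →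
        G.Adj v a → G.Adj v b → a ≠ b → G.Adj a b := by
    intro i
    obtain ⟨A'', hne, hlow, heq⟩ := tabulate_apply 6 0 peoF A (z := i)
      (by rw [h.size]; exact_mod_cast i.2)
    have hrep : Represents G τ A'' := ⟨by rw [hne 0 (by decide)]; exact h.adj,
      by rw [hne 1 (by decide)]; exact h.thr, by rw [hne 9 (by decide)]; exact h.size⟩
    have hused : ∀ a : Fin n, usedF A'' (i : ℕ) (a : ℕ) ↔ ∃ y : ℕ, y < i ∧ A' 6 y = (a : ℕ) := by
      intro a
      unfold usedF BEx
      rw [hrep.size, Int.toNat_natCast]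
      constructor
      · rintro ⟨y, -, hy, hya⟩
        have hy' : y < (i : ℕ) := by exact_mod_cast hy
        exact ⟨y, hy', (hlow y hy').symm.trans hya⟩
      · rintro ⟨y, hy, hya⟩
        exact ⟨y, hy.trans i.2, by exact_mod_cast hy, (hlow y hy).trans hya⟩
    obtain ⟨v, hvR, hv⟩ := hG.exists_simplicial
      (R := Finset.univ.filter fun v : Fin n => ∀ y : ℕ, y < i → A' 6 y ≠ (v : ℕ)) (by
        -- The fewer than `n` vertices chosen so far cannot exhaust the graph.
        by_contra hcon
        rw [Finset.not_nonempty_iff_eq_empty, Finset.filter_eq_empty_iff] at hcon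
        have hall : ∀ v : Fin n, ∃ y : ℕ, y < i ∧ A' 6 y = (v : ℕ) := fun v => by
          have := hcon (Finset.mem_univ v)
          push Not at this
          exact this
        choose f hf hf' using hall
        have := Fintype.card_le_of_injective (fun v : Fin n => (⟨f v, hf v⟩ : Fin i)) (by
          intro v w hvw
          rw [Fin.mk.injEq] at hvw
          exact fin_cast_inj.1 ((hf' v).symm.trans (hvw ▸ hf' w)))
        rw [Fintype.card_fin, Fintype.card_fin] at this
        have := i.2
        omega)
    simp only [Finset.mem_filter, Finset.mem_univ, true_and] at hvR hv
    have hiff : ∀ v : Fin n, (¬ usedF A'' (i : ℕ) (v : ℕ) ↔ ∀ y : ℕ, y < i → A' 6 y ≠ (v : ℕ)) := by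
      intro v
      rw [hused]
      push Not
      rfl
    have hsz : (A'' 9 0).toNat = n := by rw [hrep.size, Int.toNat_natCast]
    obtain ⟨w, hw, hfind, ⟨hw1, hw2⟩, -⟩ := findFirst_spec (N := (A'' 9 0).toNat)
      (P := fun v => ¬ usedF A'' (i : ℕ) v ∧ BAll (A'' 9 0).toNat fun a =>
        ¬ usedF A'' (i : ℕ) a → adjF A'' v a → BAll (A'' 9 0).toNat fun b =>
          ¬ usedF A'' (i : ℕ) b → adjF A'' v b → a ≠ b → adjF A'' a b)
      ⟨v, by rw [hsz]; exact v.2, (hiff v).2 hvR, by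
        rw [hsz]
        intro a ha hua hva b hb hub hvb hab
        obtain ⟨a, rfl⟩ : ∃ a' : Fin n, (a' : ℕ) = a := ⟨⟨a, ha⟩, rfl⟩
        obtain ⟨b, rfl⟩ : ∃ a' : Fin n, (a' : ℕ) = b := ⟨⟨b, hb⟩, rfl⟩
        rw [hrep.adjF_iff] at hva hvb ⊢
        exact hv a ((hiff a).1 hua) hva b ((hiff b).1 hub) hvb (fun h => hab (by rw [h]))⟩
    rw [hsz] at hw hw2
    obtain ⟨w, rfl⟩ : ∃ a' : Fin n, (a' : ℕ) = w := ⟨⟨w, hw⟩, rfl⟩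
    refine ⟨w, heq.trans hfind, (hiff w).1 hw1, fun a b ha hb hwa hwb hab => ?_⟩
    have := hw2 a a.2 ((hiff a).2 ha) ((hrep.adjF_iff _ _).2 hwa) b b.2 ((hiff b).2 hb)
      ((hrep.adjF_iff _ _).2 hwb) (fun h => hab (fin_cast_inj.1 h))
    exact (hrep.adjF_iff _ _).1 this
  choose π hπ hnew hsimp using key
  have hnew' : ∀ i j : Fin n, i < j → π i ≠ π j := fun i j hij heq =>
    hnew j i hij (by rw [hπ, heq])
  have hinj : Function.Injective π := by
    intro i j hij
    by_contra hne
    rcases lt_or_gt_of_ne hne with hlt | hlt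
    · exact hnew' i j hlt hij
    · exact hnew' j i hlt hij.symm
  refine ⟨Equiv.ofBijective π (Finite.injective_iff_bijective.1 hinj), hπ, ?_⟩
  intro i a b hia hib hab hadja hadjb
  have hlater : ∀ a : Fin n, i < a → ∀ y : ℕ, y < i → A' 6 y ≠ (π a : ℕ) := by
    intro a hia y hy heq
    have hya : (⟨y, hy.trans i.2⟩ : Fin n) < a := lt_trans hy hia
    exact hnew a y hya heq
  exact hsimp i (π a) (π b) (hlater a hia) (hlater b hib) hadja hadjb (hinj.ne hab)

/-! ### The recursions for the dynamic program and the choice of labels -/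

section Tables

variable {n t : ℕ} {A : Arr}

theorem Sizes.congr {A A' : Arr} (h : Sizes n t A) (h5 : A' 5 = A 5) (h9 : A' 9 = A 9) :
    Sizes n t A' := by
  obtain ⟨b0, b1, b2, b5, b6, b7, hp⟩ := h
  constructor
  case pow => rwa [h5]
  all_goals rw [h9]; assumption

theorem parF_spec (h : A 9 0 = n) (i : ℕ) :
    (∃ q : ℕ, q < n ∧ parF A i = q ∧ InSep (adjR A) i q ∧ ∀ a : ℕ, a < q → ¬ InSep (adjR A) i a) ∨
      (parF A i = n ∧ ∀ a : ℕ, a < n → ¬ InSep (adjR A) i a) := by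
  unfold parF
  rw [h, Int.toNat_natCast]
  by_cases hex : ∃ q : ℕ, q < n ∧ InSep (adjR A) i q
  · exact .inl (findFirst_spec hex)
  · push Not at hex
    exact .inr ⟨findFirst_eq_bound hex, hex⟩

theorem Sizes.branchF_eq (h : Sizes n t A) (j x : ℕ) (y : ℤ) :
    branchF A j x y = A 7 ((j * (n + 1) ^ (t * (t + 1)) + x : ℕ) : ℤ) + edgeF A j x y := by
  unfold branchF
  rw [h.b5, h.mulF_eq _ (Nat.le_mul_of_pos_left _ (by omega))]
  push_cast
  rfl

theorem Sizes.bestF_spec (h : Sizes n t A) (j : ℕ) (y : ℤ) :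
    ∃ z : ℕ, z < (n + 1) ^ (t * (t + 1)) ∧ bestF A j y = z ∧
      ∀ x : ℕ, x < (n + 1) ^ (t * (t + 1)) → branchF A j z y ≤ branchF A j x y := by
  unfold bestF
  rw [h.b5, Int.toNat_natCast]
  exact argmin_spec (by positivity) fun x => branchF A j x y

/-- Array `7` holds the table of the dynamic program. -/
def HasTable (n t : ℕ) (A : Arr) : Prop := ∀ i x : ℕ, i < n → x < (n + 1) ^ (t * (t + 1)) →
  A 7 ((i * (n + 1) ^ (t * (t + 1)) + x : ℕ) : ℤ) = lowF A i x

/-- Children have smaller numbers than their parent, so the rows read by the recursion are already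
final when row `i` is computed. -/
theorem Sizes.hasTable_tabulate (h : Sizes n t A) : HasTable n t (tabulate 7 6 dpF A) := by
  intro i x hi hx
  set M := (n + 1) ^ (t * (t + 1)) with hM
  have hMpos : 0 < M := by positivity
  set A' := tabulate 7 6 dpF A with hA'
  have hz : i * M + x < (n + 1) * M := by
    have : (i + 1) * M ≤ n * M := Nat.mul_le_mul_right _ hi
    rw [add_mul] at this ⊢
    omega
  obtain ⟨A'', hne, hlow, heq⟩ := tabulate_apply 7 6 dpF A (z := i * M + x)
    (by rw [h.b6]; exact_mod_cast hz)
  have hne' : ∀ b, b ≠ 7 → A' b = A b := fun b hb => tabulate_of_ne hb 6 dpF A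
  have hS'' : Sizes n t A'' := h.congr (hne 5 (by decide)) (hne 9 (by decide))
  have hS' : Sizes n t A' := h.congr (hne' 5 (by decide)) (hne' 9 (by decide))
  have hsame : SameProblem A' A'' := by
    refine ⟨?_, ?_, ?_, ?_, ?_⟩ <;> rw [hne _ (by decide), hne' _ (by decide)]
  rw [hA', heq, ← hA']
  unfold dpF
  rw [hS''.b5, hS''.divF_eq hz.le hMpos (Nat.le_mul_of_pos_left _ (by omega)),
    hS''.modF_eq hz.le hMpos (Nat.le_mul_of_pos_left _ (by omega))]
  have h1 : (i * M + x) / M = i := by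
    rw [add_comm, Nat.add_mul_div_right _ _ hMpos, Nat.div_eq_of_lt hx, zero_add]
  have h2 : (i * M + x) % M = x := by
    rw [add_comm, Nat.add_mul_mod_self_right, Nat.mod_eq_of_lt hx]
  rw [h1, h2]
  have hbranch : ∀ j y : ℕ, j < i → y < M → branchF A'' j y x = branchF A' j y x := by
    intro j y hj hy
    rw [hS''.branchF_eq, hS'.branchF_eq, hsame.edgeF, hlow, ← hA']
    have : (j + 1) * M ≤ i * M := Nat.mul_le_mul_right _ hj
    rw [add_mul, hM] at this
    rw [hM] at hy ⊢
    omega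
  unfold lowF BSum
  rw [hsame.costF, hsame.parF, hS''.b0, hS'.b0]
  congr 1
  refine Finset.sum_congr rfl fun j hj => ?_
  beta_reduce
  by_cases hpar : parF A' j = i
  · rw [if_pos hpar, if_pos hpar]
    have hji : j < i := by
      rcases parF_spec hS'.b0 j with ⟨q, -, hq, hsep, -⟩ | ⟨hq, -⟩
      · have h1 := hsep.1
        rw [hq] at hpar
        omega
      · rw [hq] at hpar
        omega
    have hbest : bestF A'' j x = bestF A' j x := by
      unfold bestF
      rw [hS''.b5, hS'.b5, Int.toNat_natCast]
      exact argmin_congr fun y hy => hbranch j y hji hy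
    obtain ⟨z, hz, hzb, -⟩ := hS'.bestF_spec j x
    rw [hbest, hzb]
    exact hbranch j z hji hz
  · rw [if_neg hpar, if_neg hpar]

/-- Array `8` holds the chosen schedules in reverse order. -/
def HasChoice (n : ℕ) (A : Arr) : Prop := ∀ i : ℕ, i < n → ∃ y : ℤ,
  A 8 ((n : ℤ) - 1 - i) = bestF A i y ∧
    ∀ q : ℕ, q < n → parF A i = q → y = A 8 ((n : ℤ) - 1 - q)

/-- Labels are chosen from the roots downwards. Parents have larger numbers, so storing the choices
in reverse order puts each parent before its children. -/
theorem hasChoice_tabulate (h : A 9 0 = n) : HasChoice n (tabulate 8 0 chooseF A) := by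
  intro i hi
  set A' := tabulate 8 0 chooseF A with hA'
  obtain ⟨A'', hne, hlow, heq⟩ := tabulate_apply 8 0 chooseF A (z := n - 1 - i)
    (by rw [h]; omega)
  have hne' : ∀ b, b ≠ 8 → A' b = A b := fun b hb => tabulate_of_ne hb 0 chooseF A
  have hsame : SameProblem A' A'' := by
    refine ⟨?_, ?_, ?_, ?_, ?_⟩ <;> rw [hne _ (by decide), hne' _ (by decide)]
  have h7 : A'' 7 = A' 7 := by rw [hne 7 (by decide), hne' 7 (by decide)]
  have hbest : bestF A'' = bestF A' := by
    unfold bestF branchF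
    rw [hsame.2.2.2.2, hsame.edgeF, hsame.mulF, h7]
  have h0 : A'' 9 0 = n := by rw [hne 9 (by decide), h]
  have h0' : A' 9 0 = n := by rw [hne' 9 (by decide), h]
  have hidx : ((n - 1 - i : ℕ) : ℤ) = (n : ℤ) - 1 - i := by omega
  have hidx' : (n : ℤ) - 1 - ((n : ℤ) - 1 - i) = i := by ring
  unfold chooseF at heq
  rw [h0, hidx, hidx', hbest, hsame.parF] at heq
  refine ⟨_, heq, fun q hq hpar => ?_⟩
  rw [hpar]
  have hiq : i < q := by
    rcases parF_spec h0' i with ⟨q', -, hq', hsep, -⟩ | ⟨hq', -⟩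
    · have h1 := hsep.1
      rw [hq'] at hpar
      omega
    · rw [hq'] at hpar
      omega
  have := hlow (n - 1 - q) (by omega)
  rwa [show ((n - 1 - q : ℕ) : ℤ) = (n : ℤ) - 1 - q by omega] at this

end Tables

theorem incentive_nonneg (N T τ i : ℤ) (e : ℤ → ℤ → ℤ) : 0 ≤ incentive N T τ i e := by
  unfold incentive BSum
  refine Finset.sum_nonneg fun j _ => ?_
  beta_reduce
  split_ifs
  · exact le_max_left _ _
  · exact le_rfl

/-- The chosen schedules yield an optimal partial incentive of the relabeled graph. -/
theorem exists_optimal {n t : ℕ} {G : SimpleGraph (Fin n)} {τ : Fin n → ℤ} {A : Arr}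
    {π : Fin n ≃ Fin n} (hτ : ∀ u, τ u ≤ t) (hS : Sizes n t A) (hR : Represents G τ A)
    (hπ : Ordered G π A) (hT : HasTable n t A) (hC : HasChoice n A) :
    ∃ σ : Fin n → ℕ, IsOptimalPartialIncentive (G.comap π) (fun u => τ (π u)) σ ∧
      ∀ i : Fin n, incF A (i : ℕ) (A 8 ((n : ℤ) - 1 - (i : ℕ))) = σ i := by
  classical
  set M := (n + 1) ^ (t * (t + 1)) with hM
  have hadj : ∀ u v : Fin n, adjR A (u : ℕ) (v : ℕ) ↔ (G.comap π).Adj u v := by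
    intro u v
    unfold adjR
    rw [hπ.1, hπ.1, hR.adjF_iff]
    rfl
  have hthr : ∀ u : Fin n, A 1 (A 6 (u : ℕ)) = τ (π u) := fun u => by rw [hπ.1, hR.thr]
  have hτ' : ∀ u, τ (π u) ≤ t := fun u => hτ _
  have hpen := hS.penalty_eq
  have hpen0 : 0 ≤ penalty A := by rw [hpen]; exact Nat.cast_nonneg _
  have hparent : ∀ i q : Fin n, IsParent (G.comap π) i q → parF A (i : ℕ) = (q : ℕ) := by
    intro i q hq
    have hsep : InSep (adjR A) (i : ℕ) (q : ℕ) := ⟨by exact_mod_cast hq.1, (hadj _ _).2 hq.2.1⟩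
    rcases parF_spec hS.b0 i with ⟨q', hq'n, hq', hsep', hmin⟩ | ⟨-, hno⟩
    · rw [hq', Nat.cast_inj]
      refine le_antisymm (not_lt.1 fun hlt => hmin q hlt hsep) ?_
      exact hq.2.2 ⟨q', hq'n⟩ (by exact_mod_cast hsep'.1) ((hadj i ⟨q', hq'n⟩).1 hsep'.2)
    · exact (hno q q.2 hsep).elim
  have hroot : ∀ i : ℕ, parF A i = n → ∀ y x, edgeF A i y x = 0 := by
    intro i hi y x
    rcases parF_spec hS.b0 i with ⟨q, hqn, hq, -, -⟩ | ⟨-, hno⟩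
    · rw [hq] at hi
      omega
    · unfold edgeF
      refine if_pos ⟨?_, ?_⟩
      · rw [hS.b0, Int.toNat_natCast]
        exact fun a ha hsep => (hno a ha hsep).elim
      · rw [hS.b0, Int.toNat_natCast]
        exact fun a ha hsep => (hno a ha hsep).elim
  let par : ℕ → ℕ := fun i => (parF A i).toNat
  have hpar : ∀ i : ℕ, parF A i = par i ∧ par i ≤ n := by
    intro i
    rcases parF_spec hS.b0 i with ⟨q, hqn, hq, -, -⟩ | ⟨hq, -⟩ <;> simp only [par, hq] <;> omega
  let Z : ℕ → ℕ → ℕ := fun i y => (bestF A i y).toNat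
  have hZ : ∀ i y : ℕ, bestF A i y = Z i y ∧ Z i y < M ∧
      ∀ x : ℕ, x < M → branchF A i (Z i y) y ≤ branchF A i x y := by
    intro i y
    obtain ⟨z, hz, hzb, hmin⟩ := hS.bestF_spec i y
    simp only [Z, hzb, Int.toNat_natCast, true_and]
    exact ⟨hz, hmin⟩
  let X : ℕ → ℕ := fun i => (A 8 ((n : ℤ) - 1 - i)).toNat
  have hX : ∀ i < n, A 8 ((n : ℤ) - 1 - i) = X i ∧ X i < M := by
    intro i hi
    obtain ⟨y, hy, -⟩ := hC i hi
    obtain ⟨z, hz, hzb, -⟩ := hS.bestF_spec i y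
    simp only [X, hy, hzb, Int.toNat_natCast, true_and]
    exact hz
  have hXZ : ∀ i < n, X i = Z i (X (par i)) := by
    intro i hi
    obtain ⟨y, hy, hyq⟩ := hC i hi
    -- At a root the label `y` is arbitrary, but all edge costs vanish there, so it does not affect
    -- the minimization.
    have : bestF A i y = bestF A i (X (par i)) := by
      rcases (hpar i).2.eq_or_lt with hn | hn
      · refine argmin_congr fun x _ => ?_
        unfold branchF
        rw [hroot i (by rw [(hpar i).1, hn]), hroot i (by rw [(hpar i).1, hn])]
      · rw [hyq (par i) hn (hpar i).1, (hX _ hn).1]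
    simp only [X, Z, hy, this]
  have hcost0 : ∀ i x, 0 ≤ costF A i x := by
    intro i x
    unfold costF incF
    have := incentive_nonneg (A 9 0) (A 9 1) (A 1 (A 6 i)) i fun j k => ent A x j k
    split_ifs <;> omega
  have hedge0 : ∀ i x y, 0 ≤ edgeF A i x y := by
    intro i x y
    unfold edgeF
    split_ifs <;> omega
  -- comparison with an arbitrary partial incentive
  have hle : ∀ σ' : Fin n → ℕ, IsPartialIncentive (G.comap π) (fun u => τ (π u)) σ' →
      ∑ i ∈ Finset.range n, (costF A i (X i) + edgeF A i (X i) (X (par i))) ≤ ∑ i, (σ' i : ℤ) := by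
    intro σ' hσ'
    obtain ⟨g, hg, hsched⟩ := hσ'.exists_schedule hπ.2 hadj hτ'
    have hcode := fun i => hS.exists_code (g i) (hg i)
    choose Yf hYf hYg using hcode
    obtain ⟨hval, hcompat, hinc⟩ := hsched (fun i j k => ent A (Yf i) j k) hYg
    let Y : ℕ → ℕ := fun i => if h : i < n then Yf ⟨i, h⟩ else 0
    have hY : ∀ i : Fin n, Y i = Yf i := fun i => by simp [Y]
    refine (forest_dp_optimal (M := M) (D := fun i x => A 7 ((i * M + x : ℕ) : ℤ)) (Z := Z) (X := X)
      (par := par) (c := fun i x => costF A i x) (e := fun i x y => edgeF A i x y) (Y := Y)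
      (fun i _ => (hpar i).2) (fun i _ hi y x => hroot i (by rw [(hpar i).1, hi]) y x) ?_ ?_
      (fun i hi => (hX i hi).2) hXZ (fun i hi => ?_)).trans ?_
    · intro i hi x hx
      rw [hT i x hi hx]
      unfold lowF BSum
      rw [hS.b0, Int.toNat_natCast]
      congr 1
      refine Finset.sum_congr rfl fun j _ => ?_
      beta_reduce
      rw [(hpar j).1, (hZ j x).1, hS.branchF_eq]
      simp only [Nat.cast_inj]
      rfl
    · intro i hi y x hx
      have := (hZ i y).2.2 x hx
      rw [hS.branchF_eq, hS.branchF_eq] at this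
      exact this
    · have := hY ⟨i, hi⟩
      simp only at this
      rw [this]
      exact hYf _
    · rw [Finset.sum_range]
      refine Finset.sum_le_sum fun i _ => ?_
      have hc : costF A (i : ℕ) (Y i) ≤ σ' i := by
        unfold costF incF
        rw [hY, hS.b0, hS.b1, if_pos (hval i), hthr, add_zero]
        exact hinc i
      have he : edgeF A (i : ℕ) (Y i) (Y (par i)) = 0 := by
        rcases (hpar i).2.eq_or_lt with hn | hn
        · exact hroot i (by rw [(hpar i).1, hn]) _ _
        · have hp : IsParent (G.comap π) i ⟨par i, hn⟩ := by
            rcases parF_spec hS.b0 i with ⟨q, hqn, hq, hsep, hmin⟩ | ⟨hq, -⟩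
            · obtain rfl : par i = q := by
                have := (hpar i).1
                omega
              refine ⟨by exact_mod_cast hsep.1, (hadj i ⟨par i, hn⟩).1 hsep.2, fun b hb hab => ?_⟩
              exact not_lt.1 fun hlt => hmin b hlt ⟨by exact_mod_cast hb, (hadj i b).2 hab⟩
            · have := (hpar i).1
              omega
          have hYp := hY ⟨par i, hn⟩
          simp only at hYp
          unfold edgeF
          rw [hY, hYp, hS.b0, hS.b1]
          exact if_pos (hcompat i _ hp)
      rw [he]
      linarith
  -- Comparison with the trivial incentive bounds the optimum by `n * t`, which is less than `(n +
  -- 1) * (t + 1)`. As all costs are nonnegative, no penalty can occur, so all constraints hold.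
  have hlt : ∑ i ∈ Finset.range n, (costF A i (X i) + edgeF A i (X i) (X (par i))) < penalty A := by
    refine (hle _ (isPartialIncentive_toNat _ _)).trans_lt ?_
    have : ∑ i : Fin n, ((τ (π i)).toNat : ℤ) ≤ ∑ _i : Fin n, (t : ℤ) :=
      Finset.sum_le_sum fun i _ => by
        have := hτ' i
        omega
    refine this.trans_lt ?_
    rw [hpen]
    simp only [Finset.sum_const, Finset.card_univ, Fintype.card_fin, nsmul_eq_mul]
    push_cast
    nlinarith [(Nat.cast_nonneg n : (0 : ℤ) ≤ n), (Nat.cast_nonneg t : (0 : ℤ) ≤ t)]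
  have hterm : ∀ i < n, costF A i (X i) + edgeF A i (X i) (X (par i)) < penalty A := fun i hi =>
    (Finset.single_le_sum (f := fun i : ℕ => costF A i (X i) + edgeF A i (X i) (X (par i)))
      (fun j _ => add_nonneg (hcost0 _ _) (hedge0 _ _ _)) (Finset.mem_range.2 hi)).trans_lt hlt
  have hvalid : ∀ i : Fin n, Valid n t (fun a b => adjR A a b) (i : ℕ) (fun j k => ent A (X i) j k) := by
    intro i
    by_contra hcon
    have h1 := hterm i i.2
    have h2 := hedge0 (i : ℕ) (X i) (X (par i))
    have h3 := incentive_nonneg (A 9 0) (A 9 1) (A 1 (A 6 (i : ℕ))) (i : ℕ) fun j k => ent A (X i) j k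
    unfold costF incF at h1
    rw [hS.b0, hS.b1, if_neg hcon] at h1
    rw [hS.b0, hS.b1] at h3
    omega
  have hcompat : ∀ i q : Fin n, IsParent (G.comap π) i q → Compat n t (fun a b => adjR A a b) (i : ℕ)
      (fun j k => ent A (X i) j k) (fun j k => ent A (X q) j k) := by
    intro i q hq
    by_contra hcon
    have h1 := hterm i i.2
    have h2 := hcost0 (i : ℕ) (X i)
    have hpq : par i = q := by
      have := hparent i q hq
      have := (hpar i).1
      omega
    rw [hpq] at h1
    unfold edgeF at h1
    rw [hS.b0, hS.b1, if_neg hcon] at h1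
    omega
  have hinc0 : ∀ i x, 0 ≤ incF A i x := fun i x => incentive_nonneg _ _ _ _ _
  have hsum : ∑ i : Fin n, ((incF A (i : ℕ) (X i)).toNat : ℤ) ≤
      ∑ i ∈ Finset.range n, (costF A i (X i) + edgeF A i (X i) (X (par i))) := by
    rw [Finset.sum_range]
    refine Finset.sum_le_sum fun i _ => ?_
    have h1 := hedge0 (i : ℕ) (X i) (X (par i))
    have h2 : incF A (i : ℕ) (X i) ≤ costF A (i : ℕ) (X i) := by
      unfold costF
      split_ifs <;> omega
    have := hinc0 (i : ℕ) (X i)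
    omega
  refine ⟨fun i => (incF A (i : ℕ) (X i)).toNat, ⟨?_, fun σ' hσ' => ?_⟩, fun i => ?_⟩
  · refine isPartialIncentive_of_valid (t := t) (E := fun i j k => ent A (X i) j k) hπ.2 hadj
      (fun i j k hj hk => ?_) hτ' hvalid hcompat (fun i => ?_)
    · rw [hS.ent_eq (hX i i.2).2 hj hk]
      exact Nat.cast_nonneg _
    · have h := Int.self_le_toNat (incF A (i : ℕ) (X i))
      unfold incF at h ⊢
      rw [hS.b0, hS.b1, hthr] at h ⊢
      exact h
  · have := hsum.trans (hle σ' hσ')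
    exact_mod_cast this
  · rw [(hX i i.2).1]
    exact (Int.toNat_of_nonneg (hinc0 (i : ℕ) (X i))).symm

/-! ## The program -/

/-- The largest positive threshold. -/
def maxThreshold {n : ℕ} (τ : Fin n → ℤ) : ℕ := Finset.univ.sup fun u => (τ u).toNat

theorem le_maxThreshold {n : ℕ} (τ : Fin n → ℤ) (u : Fin n) : τ u ≤ maxThreshold τ :=
  (Int.self_le_toNat _).trans
    (Nat.cast_le.2 (Finset.le_sup (f := fun u => (τ u).toNat) (Finset.mem_univ u)))

theorem maxThreshold_le {n t : ℕ} {τ : Fin n → ℤ} (h : ∀ u, τ u ≤ t) : maxThreshold τ ≤ t :=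
  Finset.sup_le fun u _ => by
    have := h u
    omega

/-- A common bound for all loop bounds. -/
def loopLimit (n t : ℕ) : ℕ := (n + 2) ^ (t * (t + 1) + t + 1)

/-- Some program brings the arrays from every admissible input into a state satisfying `Inv`, and its
number of steps is polynomial in the loop bounds. -/
def Reaches (Inv : ∀ n, SimpleGraph (Fin n) → (Fin n → ℤ) → Arr → Prop) : Prop :=
  ∃ (p : Prog) (c : ℕ), ∀ (n : ℕ) (G : SimpleGraph (Fin n)) (τ : Fin n → ℤ), IsIntervalGraph G →
    ∃ (k : ℕ) (s : State), Exec p (inputState G τ) k s ∧ Inv n G τ s.arr ∧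
      LoopBounded (loopLimit n (maxThreshold τ)) s.arr ∧
      k ≤ (loopLimit n (maxThreshold τ) + 2) ^ c

variable {Inv Inv' : ∀ n, SimpleGraph (Fin n) → (Fin n → ℤ) → Arr → Prop}

theorem Reaches.step (h : Reaches Inv) {F : Arr → Arr} (hF : PStage F)
    (hInv : ∀ n G τ A, IsIntervalGraph G → Inv n G τ A → Inv' n G τ (F A))
    (hB : ∀ n G τ A, Inv n G τ A → LoopBounded (loopLimit n (maxThreshold τ)) A →
      LoopBounded (loopLimit n (maxThreshold τ)) (F A)) : Reaches Inv' := by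
  obtain ⟨p, c, h⟩ := h
  obtain ⟨q, d, hF⟩ := hF
  refine ⟨.seq p q, c + d + 1, fun n G τ hG => ?_⟩
  obtain ⟨k, s, e, hI, hL, hk⟩ := h n G τ hG
  obtain ⟨s', l, e', ha, hl⟩ := hF s _ hL
  exact ⟨_, s', .seq e e', ha ▸ hInv n G τ _ hG hI, ha ▸ hB n G τ _ hI hL, add_le_add_two_pow hk hl⟩

theorem Reaches.setBound (h : Reaches Inv) (j : ℤ) {f : Arr → ℤ} (hf : PComp fun A _ => f A)
    (hB : ∀ n G τ A, Inv n G τ A → f A ≤ loopLimit n (maxThreshold τ))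
    (hInv : ∀ n G τ A, IsIntervalGraph G → Inv n G τ A → Inv' n G τ (setBound j f A)) :
    Reaches Inv' := by
  refine h.step (PStage.setBound j hf) hInv fun n G τ A hI hL i => ?_
  unfold PartialIncentives.setBound
  rw [Function.update_self]
  by_cases hi : i = j
  · rw [hi, Function.update_self]
    exact hB n G τ A hI
  · rw [Function.update_of_ne hi]
    exact hL i

theorem Reaches.tabulate (h : Reaches Inv) (a : ℕ) (j : ℤ) (ha : a ≠ 9) {f : Arr → ℤ → ℤ}
    (hf : PComp fun A v => f A (v 0))
    (hInv : ∀ n G τ A, IsIntervalGraph G → Inv n G τ A → Inv' n G τ (tabulate a j f A)) :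
    Reaches Inv' := by
  refine h.step (PStage.tabulate a j ha hf) hInv fun n G τ A _ hL i => ?_
  rw [tabulate_of_ne ha.symm]
  exact hL i

theorem setBound_apply (j : ℤ) (f : Arr → ℤ) (A : Arr) : setBound j f A 9 j = f A := by
  simp [setBound]

theorem setBound_of_ne {i j : ℤ} (h : i ≠ j) (f : Arr → ℤ) (A : Arr) :
    setBound j f A 9 i = A 9 i := by
  simp [setBound, Function.update_of_ne h]

theorem setBound_arr {a : ℕ} (h : a ≠ 9) (j : ℤ) (f : Arr → ℤ) (A : Arr) :
    setBound j f A a = A a := by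
  simp [setBound, Function.update_of_ne h]

theorem Represents.setBound {n : ℕ} {G : SimpleGraph (Fin n)} {τ : Fin n → ℤ} {A : Arr}
    (h : Represents G τ A) {j : ℤ} (hj : 0 ≠ j) (f : Arr → ℤ) : Represents G τ (setBound j f A) :=
  ⟨by rw [setBound_arr (by decide)]; exact h.adj, by rw [setBound_arr (by decide)]; exact h.thr,
    by rw [setBound_of_ne hj]; exact h.size⟩

theorem Represents.tabulate {n : ℕ} {G : SimpleGraph (Fin n)} {τ : Fin n → ℤ} {A : Arr}
    (h : Represents G τ A) {a : ℕ} (h0 : 0 ≠ a) (h1 : 1 ≠ a) (h9 : 9 ≠ a) (j : ℤ)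
    (f : Arr → ℤ → ℤ) : Represents G τ (tabulate a j f A) :=
  ⟨by rw [tabulate_of_ne h0]; exact h.adj, by rw [tabulate_of_ne h1]; exact h.thr,
    by rw [tabulate_of_ne h9]; exact h.size⟩

theorem loopLimit_of_pow {n t m : ℕ} (e : ℕ) (he : e ≤ t * (t + 1) + t + 1) (hm : m ≤ (n + 2) ^ e) :
    (m : ℤ) ≤ loopLimit n t :=
  Nat.cast_le.2 (hm.trans (Nat.pow_le_pow_right (by omega) he))

theorem reaches_represents : Reaches fun _ G τ A => Represents G τ A := by
  refine ⟨.put 9 (.lit 0) (.reg 0), 3, fun n G τ _ => ⟨_, _, .put _ _ _ _, ⟨?_, ?_, ?_⟩, ?_,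
    le_add_two_pow _ 3⟩⟩
  · intro u v
    -- The row-major index determines the pair, by quotient and remainder modulo `n`.
    have hiff : (∃ u' v' : Fin n, G.Adj u' v' ∧
        (u : ℕ) * (n : ℤ) + (v : ℕ) = (u' : ℕ) * (n : ℤ) + (v' : ℕ)) ↔ G.Adj u v := by
      constructor
      · rintro ⟨u', v', hadj, heq⟩
        have heq' : (u : ℕ) * n + v = u' * n + v' := by exact_mod_cast heq
        have hn : 0 < n := u.pos
        have h1 := congrArg (· / n) heq'
        have h2 := congrArg (· % n) heq'
        simp only [Nat.mul_add_mod_self_right, Nat.mod_eq_of_lt v.2, Nat.mod_eq_of_lt v'.2] at h2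
        simp only [add_comm _ (v : ℕ), add_comm _ (v' : ℕ), Nat.add_mul_div_right _ _ hn,
          Nat.div_eq_of_lt v.2, Nat.div_eq_of_lt v'.2, zero_add] at h1
        rwa [Fin.ext h1, Fin.ext h2]
      · exact fun h => ⟨u, v, h, rfl⟩
    dsimp only
    rw [Function.update_of_ne (by decide)]
    simp only [inputState, if_true]
    rw [← hiff]
    split_ifs with h
    · exact iff_of_true one_pos h
    · exact iff_of_false (lt_irrefl 0) h
  · intro u
    dsimp only
    rw [Function.update_of_ne (by decide)]
    simp [inputState]
  · simp [inputState, Expr.eval]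
  · intro j
    have h := loopLimit_of_pow (n := n) (t := maxThreshold τ) (m := n) 1 (by omega) (by rw [pow_one]; omega)
    by_cases hj : j = 0
    · simpa [hj, Expr.eval, inputState] using h
    · simp [Expr.eval, inputState, Function.update_of_ne hj]

open Classical in
/-- The largest positive threshold, computed from the input. -/
noncomputable def maxThresholdF (A : Arr) : ℤ :=
  if A 9 0 ≤ 0 then 0 else max 0 (A 1 (argmin (A 9 0).toNat fun u => 0 - A 1 u))

theorem PComp.maxThresholdF : PComp fun A _ => maxThresholdF A := by
  unfold PartialIncentives.maxThresholdF
  refine .ite (.le (.bound 0) (.const 0)) (.const 0) (.max (.const 0) (.get 1 ?_))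
  exact PComp.argmin 0 (f := fun A _ u => 0 - A 1 u) (.sub (.const 0) (.get 1 (.var 0)))

/-- The number `t` is not part of the input, so the program works with the least admissible value,
found by minimizing the negated thresholds. -/
theorem Represents.maxThresholdF_eq {n : ℕ} {G : SimpleGraph (Fin n)} {τ : Fin n → ℤ} {A : Arr}
    (h : Represents G τ A) : maxThresholdF A = maxThreshold τ := by
  unfold maxThresholdF
  rw [h.size, Int.toNat_natCast]
  by_cases hn : n = 0
  · subst hn
    simp [maxThreshold]
  · rw [if_neg (by omega)]
    obtain ⟨z, hz, he, hmin⟩ := argmin_spec (Nat.pos_of_ne_zero hn) fun u => 0 - A 1 u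
    rw [he]
    have hle : ∀ u : Fin n, τ u ≤ A 1 z := fun u => by
      have := hmin u u.2
      rw [h.thr] at this
      omega
    have hz' : A 1 z = τ ⟨z, hz⟩ := h.thr ⟨z, hz⟩
    have h1 := le_maxThreshold τ ⟨z, hz⟩
    have h2 := maxThreshold_le (τ := τ) (t := (A 1 z).toNat)
      fun u => (hle u).trans (Int.self_le_toNat _)
    omega

/-- The powers of `n + 1`, computed recursively. -/
def powF (A : Arr) (z : ℤ) : ℤ := if z ≤ 0 then 1 else BSum (A 9 2).toNat fun _ => A 5 (z - 1)

theorem PComp.powF : PComp fun A v => powF A (v 0) :=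
  .ite (.le (.var 0) (.const 0)) (.const 1) (.mulBound 2 (.get 5 (.sub (.var 0) (.const 1))))

theorem tabulate_powF {n N : ℕ} {A : Arr} (h2 : A 9 2 = (n + 1 : ℕ)) (h4 : A 9 4 = (N + 1 : ℕ))
    {z : ℕ} (hz : z ≤ N) : tabulate 5 4 powF A 5 z = ((n + 1) ^ z : ℕ) := by
  induction z with
  | zero =>
    obtain ⟨A', -, -, heq⟩ := tabulate_apply 5 4 powF A (z := 0) (by rw [h4]; exact_mod_cast Nat.succ_pos N)
    rw [heq]
    simp [powF]
  | succ z ih =>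
    obtain ⟨A', hne, hlow, heq⟩ := tabulate_apply 5 4 powF A (z := z + 1)
      (by rw [h4]; exact_mod_cast Nat.lt_succ_of_le hz)
    rw [heq]
    unfold powF
    have hz1 : ((z + 1 : ℕ) : ℤ) - 1 = z := by omega
    rw [if_neg (by omega), BSum_const, hne 9 (by decide), h2, Int.toNat_natCast, hz1,
      hlow z (Nat.lt_succ_self z), ih (by omega)]
    push_cast
    ring

/-- Each bound is computed by loops over bounds already set, in the order `t`, `n + 1`, `t + 1`,
`K`, `K + 1`, powers, `M`, `(n + 1) * M`. A number `m` that depends on `t` alone stays below the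
limit since `m < 2 ^ m ≤ (n + 2) ^ m`. -/
theorem reaches_sizes : Reaches fun n G τ A => Represents G τ A ∧ Sizes n (maxThreshold τ) A := by
  have s1 : Reaches fun n G τ A => Represents G τ A ∧ A 9 1 = maxThreshold τ :=
    reaches_represents.setBound 1 PComp.maxThresholdF
      (fun n G τ A h => by
        rw [h.maxThresholdF_eq]
        exact loopLimit_of_pow (maxThreshold τ) (by omega)
          (Nat.lt_two_pow_self.le.trans (Nat.pow_le_pow_left (by omega) _)))
      (fun n G τ A _ h => ⟨h.setBound (by decide) _, by rw [setBound_apply, h.maxThresholdF_eq]⟩)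
  have s2 : Reaches fun n G τ A => (Represents G τ A ∧ A 9 1 = maxThreshold τ) ∧
      A 9 2 = (n + 1 : ℕ) :=
    s1.setBound 2 (f := fun A => A 9 0 + 1) (.add (.bound 0) (.const 1))
      (fun n G τ A h => by
        rw [h.1.size]
        exact loopLimit_of_pow (m := n + 1) 1 (by omega) (by rw [pow_one]; omega))
      (fun n G τ A _ h => ⟨⟨h.1.setBound (by decide) _, by rw [setBound_of_ne (by decide), h.2]⟩,
        by rw [setBound_apply, h.1.size]; rfl⟩)
  have s3 : Reaches fun n G τ A => ((Represents G τ A ∧ A 9 1 = maxThreshold τ) ∧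
      A 9 2 = (n + 1 : ℕ)) ∧ A 9 7 = (maxThreshold τ + 1 : ℕ) :=
    s2.setBound 7 (f := fun A => A 9 1 + 1) (.add (.bound 1) (.const 1))
      (fun n G τ A h => by
        rw [h.1.2]
        exact loopLimit_of_pow (m := maxThreshold τ + 1) (maxThreshold τ + 1) (by omega)
          (Nat.lt_two_pow_self.le.trans (Nat.pow_le_pow_left (by omega) _)))
      (fun n G τ A _ ⟨⟨h, h1⟩, h2⟩ => ⟨⟨⟨h.setBound (by decide) _,
        by rw [setBound_of_ne (by decide), h1]⟩, by rw [setBound_of_ne (by decide), h2]⟩,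
        by rw [setBound_apply, h1]; rfl⟩)
  have s4 : Reaches fun n G τ A => (((Represents G τ A ∧ A 9 1 = maxThreshold τ) ∧
      A 9 2 = (n + 1 : ℕ)) ∧ A 9 7 = (maxThreshold τ + 1 : ℕ)) ∧
      A 9 3 = (maxThreshold τ * (maxThreshold τ + 1) : ℕ) := by
    have hval : ∀ (A : Arr) (t : ℕ), A 9 1 = t → A 9 7 = (t + 1 : ℕ) →
        (BSum (A 9 1).toNat fun _ => A 9 7) = (t * (t + 1) : ℕ) := fun A t h1 h7 => by
      rw [BSum_const, h1, h7, Int.toNat_natCast]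
      push_cast
      ring
    exact s3.setBound 3 (f := fun A => BSum (A 9 1).toNat fun _ => A 9 7) (.mulBound 1 (.bound 7))
      (fun n G τ A h => by
        rw [hval A _ h.1.1.2 h.2]
        exact loopLimit_of_pow (maxThreshold τ * (maxThreshold τ + 1)) (by omega)
          (Nat.lt_two_pow_self.le.trans (Nat.pow_le_pow_left (by omega) _)))
      (fun n G τ A _ ⟨⟨⟨h, h1⟩, h2⟩, h7⟩ => ⟨⟨⟨⟨h.setBound (by decide) _,
        by rw [setBound_of_ne (by decide), h1]⟩, by rw [setBound_of_ne (by decide), h2]⟩,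
        by rw [setBound_of_ne (by decide), h7]⟩, by rw [setBound_apply, hval A _ h1 h7]⟩)
  have s5 : Reaches fun n G τ A => ((((Represents G τ A ∧ A 9 1 = maxThreshold τ) ∧
      A 9 2 = (n + 1 : ℕ)) ∧ A 9 7 = (maxThreshold τ + 1 : ℕ)) ∧
      A 9 3 = (maxThreshold τ * (maxThreshold τ + 1) : ℕ)) ∧
      A 9 4 = (maxThreshold τ * (maxThreshold τ + 1) + 1 : ℕ) :=
    s4.setBound 4 (f := fun A => A 9 3 + 1) (.add (.bound 3) (.const 1))
      (fun n G τ A h => by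
        rw [h.2]
        exact loopLimit_of_pow (m := maxThreshold τ * (maxThreshold τ + 1) + 1)
          (maxThreshold τ * (maxThreshold τ + 1) + 1) (by omega)
          (Nat.lt_two_pow_self.le.trans (Nat.pow_le_pow_left (by omega) _)))
      (fun n G τ A _ ⟨⟨⟨⟨h, h1⟩, h2⟩, h7⟩, h3⟩ => ⟨⟨⟨⟨⟨h.setBound (by decide) _,
        by rw [setBound_of_ne (by decide), h1]⟩, by rw [setBound_of_ne (by decide), h2]⟩,
        by rw [setBound_of_ne (by decide), h7]⟩, by rw [setBound_of_ne (by decide), h3]⟩,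
        by rw [setBound_apply, h3]; rfl⟩)
  have s6 : Reaches fun n G τ A => ((((Represents G τ A ∧ A 9 1 = maxThreshold τ) ∧
      A 9 2 = (n + 1 : ℕ)) ∧ A 9 7 = (maxThreshold τ + 1 : ℕ)) ∧
      A 9 3 = (maxThreshold τ * (maxThreshold τ + 1) : ℕ)) ∧
      ∀ z : ℕ, z ≤ maxThreshold τ * (maxThreshold τ + 1) → A 5 z = ((n + 1) ^ z : ℕ) :=
    s5.tabulate 5 4 (by decide) PComp.powF
      (fun n G τ A _ ⟨⟨⟨⟨⟨h, h1⟩, h2⟩, h7⟩, h3⟩, h4⟩ =>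
        ⟨⟨⟨⟨⟨h.tabulate (by decide) (by decide) (by decide) _ _,
        by rw [tabulate_of_ne (by decide), h1]⟩, by rw [tabulate_of_ne (by decide), h2]⟩,
        by rw [tabulate_of_ne (by decide), h7]⟩, by rw [tabulate_of_ne (by decide), h3]⟩,
        fun z hz => tabulate_powF h2 h4 hz⟩)
  have s7 : Reaches fun n G τ A => ((((Represents G τ A ∧ A 9 1 = maxThreshold τ) ∧
      A 9 2 = (n + 1 : ℕ)) ∧ A 9 7 = (maxThreshold τ + 1 : ℕ)) ∧
      A 9 5 = ((n + 1) ^ (maxThreshold τ * (maxThreshold τ + 1)) : ℕ)) ∧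
      ∀ z : ℕ, z ≤ maxThreshold τ * (maxThreshold τ + 1) → A 5 z = ((n + 1) ^ z : ℕ) :=
    s6.setBound 5 (f := fun A => A 5 (A 9 3)) (.get 5 (.bound 3))
      (fun n G τ A h => by
        rw [h.1.2, h.2 _ le_rfl]
        exact loopLimit_of_pow (maxThreshold τ * (maxThreshold τ + 1)) (by omega)
          (Nat.pow_le_pow_left (by omega) _))
      (fun n G τ A _ ⟨⟨⟨⟨⟨h, h1⟩, h2⟩, h7⟩, h3⟩, hp⟩ => ⟨⟨⟨⟨⟨h.setBound (by decide) _,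
        by rw [setBound_of_ne (by decide), h1]⟩, by rw [setBound_of_ne (by decide), h2]⟩,
        by rw [setBound_of_ne (by decide), h7]⟩, by rw [setBound_apply, h3, hp _ le_rfl]⟩,
        by rw [setBound_arr (by decide)]; exact hp⟩)
  have hval : ∀ (A : Arr) (n m : ℕ), A 9 2 = (n + 1 : ℕ) → A 9 5 = m →
      (BSum (A 9 2).toNat fun _ => A 9 5) = ((n + 1) * m : ℕ) := fun A t m h1 h7 => by
    rw [BSum_const, h1, h7, Int.toNat_natCast]
    push_cast
    ring
  exact s7.setBound 6 (f := fun A => BSum (A 9 2).toNat fun _ => A 9 5) (.mulBound 2 (.bound 5))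
    (fun n G τ A h => by
      rw [hval A _ _ h.1.1.1.2 h.1.2, ← pow_succ']
      exact loopLimit_of_pow (maxThreshold τ * (maxThreshold τ + 1) + 1) (by omega)
        (Nat.pow_le_pow_left (by omega) _))
    (fun n G τ A _ ⟨⟨⟨⟨⟨h, h1⟩, h2⟩, h7⟩, h5⟩, hp⟩ => ⟨h.setBound (by decide) _,
      by rw [setBound_of_ne (by decide), h.size], by rw [setBound_of_ne (by decide), h1],
      by rw [setBound_of_ne (by decide), h2], by rw [setBound_of_ne (by decide), h5],
      by rw [setBound_apply, hval A _ _ h2 h5], by rw [setBound_of_ne (by decide), h7],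
      by rw [setBound_arr (by decide)]; exact hp⟩)

theorem Ordered.outF_eq {n : ℕ} {G : SimpleGraph (Fin n)} {π : Fin n ≃ Fin n} {A : Arr}
    (h : Ordered G π A) (h0 : A 9 0 = n) (i : Fin n) :
    outF A (π i : ℕ) = incF A (i : ℕ) (A 8 ((n : ℤ) - 1 - (i : ℕ))) := by
  unfold outF BSum
  rw [h0, Int.toNat_natCast, Finset.sum_range, Finset.sum_eq_single i]
  · beta_reduce
    rw [if_pos (h.1 i)]
  · intro j _ hj
    beta_reduce
    rw [if_neg]
    rw [h.1, fin_cast_inj]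
    exact π.injective.ne hj
  · exact fun hi => (hi (Finset.mem_univ i)).elim

theorem reaches_output : Reaches fun n G τ A => ∃ σ : Fin n → ℕ,
    IsOptimalPartialIncentive G τ σ ∧ ∀ u : Fin n, A 2 (u : ℕ) = σ u := by
  have hsizes : ∀ {n t a : ℕ} {A : Arr} {j f}, 5 ≠ a → 9 ≠ a → Sizes n t A →
      Sizes n t (tabulate a j f A) := fun h5 h9 h =>
    h.congr (tabulate_of_ne h5 _ _ _) (tabulate_of_ne h9 _ _ _)
  have s1 : Reaches fun n G τ A => (Represents G τ A ∧ Sizes n (maxThreshold τ) A) ∧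
      ∃ π, Ordered G π A :=
    reaches_sizes.tabulate 6 0 (by decide) (PComp.peoF (.var 0))
      (fun n G τ A hG h => ⟨⟨h.1.tabulate (by decide) (by decide) (by decide) _ _,
        hsizes (by decide) (by decide) h.2⟩, exists_ordered hG h.1⟩)
  have hord : ∀ {n : ℕ} {G : SimpleGraph (Fin n)} {π : Fin n ≃ Fin n} {A : Arr} {a j f}, 6 ≠ a →
      Ordered G π A → Ordered G π (tabulate a j f A) := fun h6 h =>
    ⟨by rw [tabulate_of_ne h6]; exact h.1, h.2⟩
  have s2 : Reaches fun n G τ A => ((Represents G τ A ∧ Sizes n (maxThreshold τ) A) ∧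
      ∃ π, Ordered G π A) ∧ HasTable n (maxThreshold τ) A :=
    s1.tabulate 7 6 (by decide) PComp.dpF
      (fun n G τ A hG ⟨⟨h, hS⟩, π, hπ⟩ => ⟨⟨⟨h.tabulate (by decide) (by decide) (by decide) _ _,
        hsizes (by decide) (by decide) hS⟩, π, hord (by decide) hπ⟩, hS.hasTable_tabulate⟩)
  have s3 : Reaches fun n G τ A => ((Represents G τ A ∧ Sizes n (maxThreshold τ) A) ∧
      ∃ π, Ordered G π A) ∧ HasTable n (maxThreshold τ) A ∧ HasChoice n A :=
    s2.tabulate 8 0 (by decide) PComp.chooseF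
      (fun n G τ A hG ⟨⟨⟨h, hS⟩, π, hπ⟩, hT⟩ =>
        ⟨⟨⟨h.tabulate (by decide) (by decide) (by decide) _ _,
        hsizes (by decide) (by decide) hS⟩, π, hord (by decide) hπ⟩, by
          have hsame : SameProblem A (tabulate 8 0 chooseF A) := by
            refine ⟨?_, ?_, ?_, ?_, ?_⟩ <;> exact tabulate_of_ne (by decide) _ _ _
          -- The table equation does not involve array `8`, so it survives the filling of that
          -- array.
          have hlow : lowF (tabulate 8 0 chooseF A) = lowF A := by
            unfold lowF bestF branchF
            rw [hsame.costF, hsame.parF, hsame.edgeF, hsame.mulF, hsame.2.2.2.2,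
              tabulate_of_ne (b := 7) (by decide)]
          intro i x hi hx
          rw [tabulate_of_ne (b := 7) (by decide), hlow]
          exact hT i x hi hx, hasChoice_tabulate h.size⟩)
  refine s3.tabulate 2 0 (by decide) PComp.outF fun n G τ A _ ⟨⟨⟨h, hS⟩, π, hπ⟩, hT, hC⟩ => ?_
  obtain ⟨σ, hopt, hσ⟩ := exists_optimal (le_maxThreshold τ) hS h hπ hT hC
  refine ⟨fun u => σ (π.symm u), IsOptimalPartialIncentive.of_comap π (by simpa using hopt),
    fun u => ?_⟩
  obtain ⟨A', hne, -, heq⟩ := tabulate_apply 2 0 outF A (z := u) (by rw [h.size]; exact_mod_cast u.2)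
  have hsame : SameProblem A A' := by
    refine ⟨?_, ?_, ?_, ?_, ?_⟩ <;> exact hne _ (by decide)
  have hout : outF A' = outF A := by
    unfold outF
    rw [hsame.incF, hsame.2.2.2.1, hsame.2.2.2.2, hne 8 (by decide)]
  rw [heq, hout, ← hσ, ← hπ.outF_eq h.size, Equiv.apply_symm_apply]

/-- The base satisfies `n + 2 ≤ max n 2 ^ 2`, and the doubled exponent `2 * (t ^ 2 + 2 * t + 2)` is
at most `6 * (t ^ 2 + 1)`. -/
theorem loopLimit_add_two_le (n t : ℕ) : loopLimit n t + 2 ≤ max n 2 ^ (6 * (t ^ 2 + 1)) := by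
  have h1 : n + 2 ≤ max n 2 ^ 2 := by
    have ha : n ≤ max n 2 := le_max_left _ _
    have hb : 2 ≤ max n 2 := le_max_right _ _
    nlinarith
  have h2 : loopLimit n t + 2 ≤ (n + 2) ^ (t * (t + 1) + t + 1 + 1) := by
    unfold loopLimit
    have : 2 ≤ (n + 2) ^ (t * (t + 1) + t + 1) :=
      (show 2 ≤ n + 2 by omega).trans (Nat.le_self_pow (by omega) _)
    rw [pow_succ (n + 2) (t * (t + 1) + t + 1)]
    nlinarith
  refine h2.trans ((Nat.pow_le_pow_left h1 _).trans ?_)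
  rw [← pow_mul]
  refine Nat.pow_le_pow_right (by positivity) ?_
  nlinarith [sq_nonneg ((t : ℤ) - 1), Nat.zero_le t, sq_nonneg (t - 1 : ℤ)]

end PartialIncentives

theorem theorem6 :
    ∃ (P : PartialIncentives.Prog) (c : ℕ),
      ∀ (t n : ℕ) (G : SimpleGraph (Fin n)) (τ : Fin n → ℤ),
        PartialIncentives.IsIntervalGraph G →
        (∀ u, τ u ≤ (t : ℤ)) →
        ∃ (k : ℕ) (s : PartialIncentives.State) (σ : Fin n → ℕ),
          PartialIncentives.Exec P (PartialIncentives.inputState G τ) k s ∧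
          k ≤ (max n 2) ^ (c * (t ^ 2 + 1)) ∧
          PartialIncentives.IsOutput s σ ∧
          PartialIncentives.IsOptimalPartialIncentive G τ σ := by
  obtain ⟨P, c, h⟩ := PartialIncentives.reaches_output
  refine ⟨P, 6 * c, fun t n G τ hG hτ => ?_⟩
  obtain ⟨k, s, e, ⟨σ, hopt, hσ⟩, -, hk⟩ := h n G τ hG
  refine ⟨k, s, σ, e, hk.trans ?_, hσ, hopt⟩
  -- The running time is governed by the largest positive threshold, so the bound holds for every
  -- admissible `t` at once.
  have ht := PartialIncentives.maxThreshold_le hτ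
  refine (Nat.pow_le_pow_left (PartialIncentives.loopLimit_add_two_le _ _) c).trans ?_
  rw [← pow_mul]
  refine Nat.pow_le_pow_right (by positivity) ?_
  have := Nat.pow_le_pow_left ht 2
  nlinarith
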